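/- Let $\mathcal D$ be the set of two-qubit density matrices, i.e. of $4\times 4$ complex Hermitian positive semidefinite matrices $\rho$ of trace one. It is a compact convex body with non-empty interior in the 15-dimensional real affine space of Hermitian matrices of trace one. The Hilbert–Schmidt (HS) probability measure on $\mathcal D$ is the normalized Euclidean volume for the metric $\tfrac12\operatorname{Tr}[(d\rho)^2]$ of that space, and $\langle\cdot\rangle$ denotes expectation with respect to it. Let $\rho^{PT}$ be the partial transpose, obtained by transposing in place the four $2\times2$ blocks of $\rho$. Write $|\cdot|$ for the determinant and $(x)_m = x(x+1)\cdots(x+m-1)$. Put $$\hat A_1(k)=k^3+6k^2-k-42,$$ $$\hat A_2(k)=k^6+15k^5+67k^4+45k^3+220k^2+4260k+10944,$$ $$\hat A_3(k)=k^9+27k^8+282k^7+1458k^6+5373k^5+27783k^4+80168k^3-456948k^2-3684384k-6929280,$$ $$\hat A_4(k)=k^{12}+42k^{11}+749k^{10}+7542k^9+50991k^8+278478k^7+1160375k^6+1080858k^5-13235252k^4+64072440k^3+1342859616k^2+6039653760k+9247219200,$$ $$\hat B_n(k)=2^{6n}\left(k+\tfrac92\right)_n\left(2k+\tfrac{17}{2}\right)_{2n}.$$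 Then all the expectations $\langle|\rho|^k|\rho^{PT}|^n\rangle$ ($k,n=0,1,2,\dots$) exist, $\langle|\rho|^k\rangle>0$, each $\hat A_n$ is monic of degree $3n$, and for $n=1,2,3,4$ and all $k=0,1,2,\dots$ $$\frac{\langle|\rho|^k|\rho^{PT}|^n\rangle}{\langle|\rho|^k\rangle}=\frac{\hat A_n(k)}{\hat B_n(k)}.$$ In particular, for all $k=0,1,2,\dots$, $$\langle|\rho|^k|\rho^{PT}|\rangle=\frac{k(k(k+6)-1)-42}{8(2k+9)(4k+17)(4k+19)}\,\langle|\rho|^k\rangle,$$ $$\langle|\rho|^k|\rho^{PT}|^2\rangle=\frac{k(k(k(k(k(k+15)+67)+45)+220)+4260)+10944}{64(2k+9)(2k+11)(4k+17)(4k+19)(4k+21)(4k+23)}\,\langle|\rho|^k\rangle.$$ -/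

import Mathlib

open MeasureTheory ProbabilityTheory Matrix Polynomial
open scoped ComplexOrder

noncomputable section

/-- Basis labels of a two-qubit system: the pair `(a, b)` labels the product vector `|a⟩ ⊗ |b⟩`. -/
abbrev TwoQubit : Type := Fin 2 × Fin 2

/-- A two-qubit density matrix: a `4 × 4` complex (Hermitian) positive semidefinite matrix of
unit trace. -/
def IsDensityMatrix (ρ : Matrix TwoQubit TwoQubit ℂ) : Prop :=
  ρ.PosSemidef ∧ ρ.trace = 1

/-- Partial transpose: in the `2 × 2` array of `2 × 2` blocks (block indices `i.1`, `j.1`), each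
block is transposed in place. -/
def partialTranspose (ρ : Matrix TwoQubit TwoQubit ℂ) : Matrix TwoQubit TwoQubit ℂ :=
  Matrix.of fun i j => ρ (i.1, j.2) (j.1, i.2)

/-- The matrix with the entries listed in `x`. -/
def entryMatrix (x : EuclideanSpace ℂ (TwoQubit × TwoQubit)) : Matrix TwoQubit TwoQubit ℂ :=
  Matrix.of fun i j => x (i, j)

/-- The 15-dimensional real Euclidean space of traceless Hermitian `4 × 4` matrices, with the
Hilbert-Schmidt (Frobenius) inner product inherited from the space of all complex `4 × 4`
matrices. It is the tangent space of the space of Hermitian matrices of unit trace. -/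
def TracelessHermitian : Submodule ℝ (EuclideanSpace ℂ (TwoQubit × TwoQubit)) where
  carrier := {x | (entryMatrix x).IsHermitian ∧ (entryMatrix x).trace = 0}
  zero_mem' := by
    constructor
    · ext i j; simp [entryMatrix]
    · simp [entryMatrix, Matrix.trace]
  add_mem' := by
    rintro x y ⟨hx, hx'⟩ ⟨hy, hy'⟩
    have h : entryMatrix (x + y) = entryMatrix x + entryMatrix y := by
      ext i j; simp [entryMatrix]
    refine ⟨?_, ?_⟩
    · rw [h]; exact hx.add hy
    · rw [h, Matrix.trace_add, hx', hy', add_zero]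
  smul_mem' := by
    rintro c x ⟨hx, hx'⟩
    have h : entryMatrix (c • x) = c • entryMatrix x := by
      ext i j; simp [entryMatrix]
    refine ⟨?_, ?_⟩
    · rw [h]
      show (c • entryMatrix x)ᴴ = _
      rw [Matrix.conjTranspose_smul, hx.eq]; simp
    · rw [h, Matrix.trace_smul, hx', smul_zero]

/-- The Hermitian matrix `I/4 + x` of unit trace. -/
def stateOf (x : TracelessHermitian) : Matrix TwoQubit TwoQubit ℂ :=
  (1 / 4 : ℂ) • (1 : Matrix TwoQubit TwoQubit ℂ) + entryMatrix x

/-- The distance used on `TracelessHermitian` is the Hilbert-Schmidt distance of the matrices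
parametrized. -/
theorem dist_sq_eq_trace (x y : TracelessHermitian) :
    ((dist x y ^ 2 : ℝ) : ℂ) = ((stateOf x - stateOf y) * (stateOf x - stateOf y)).trace := by
  have hs : stateOf x - stateOf y = entryMatrix (x - y : TracelessHermitian) := by
    ext i j; simp [stateOf, entryMatrix]
  rw [hs, dist_eq_norm]
  generalize x - y = z
  have hz : (entryMatrix z).IsHermitian := z.2.1
  have h1 : ‖z‖ ^ 2 = ∑ i, ∑ j, ‖(z : EuclideanSpace ℂ (TwoQubit × TwoQubit)) (i, j)‖ ^ 2 := by
    rw [Submodule.coe_norm, EuclideanSpace.norm_sq_eq, Fintype.sum_prod_type]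
  rw [h1]
  push_cast
  simp only [Matrix.trace, Matrix.diag_apply, Matrix.mul_apply]
  refine Finset.sum_congr rfl fun i _ => Finset.sum_congr rfl fun j _ => ?_
  rw [← hz.apply j i]
  exact (Complex.mul_conj' _).symm

/-- `stateOf` parametrizes exactly the Hermitian matrices of unit trace, each of them once. -/
theorem existsUnique_stateOf_eq (ρ : Matrix TwoQubit TwoQubit ℂ) :
    (∃! x, stateOf x = ρ) ↔ ρ.IsHermitian ∧ ρ.trace = 1 := by
  constructor
  · rintro ⟨x, rfl, -⟩
    refine ⟨?_, ?_⟩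
    · refine Matrix.IsHermitian.add ?_ x.2.1
      ext i j
      by_cases h : i = j <;> simp [h, eq_comm]
    · rw [stateOf, Matrix.trace_add, x.2.2, Matrix.trace_smul, Matrix.trace_one]
      simp
  · rintro ⟨h1, h2⟩
    have hH : ((1 / 4 : ℂ) • (1 : Matrix TwoQubit TwoQubit ℂ)).IsHermitian := by
      ext i j
      by_cases h : i = j <;> simp [h, eq_comm]
    let x : EuclideanSpace ℂ (TwoQubit × TwoQubit) :=
      WithLp.toLp 2 fun p => (ρ - (1 / 4 : ℂ) • (1 : Matrix TwoQubit TwoQubit ℂ)) p.1 p.2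
    have hx : entryMatrix x = ρ - (1 / 4 : ℂ) • (1 : Matrix TwoQubit TwoQubit ℂ) := by
      ext i j; simp [x, entryMatrix]
    refine ⟨⟨x, ?_, ?_⟩, ?_, ?_⟩
    · rw [hx]; exact h1.sub hH
    · rw [hx, Matrix.trace_sub, h2, Matrix.trace_smul, Matrix.trace_one]
      simp
    · simp [stateOf, hx]
    · rintro y rfl
      ext p
      have := congrFun (congrFun hx p.1) p.2
      simpa [stateOf, entryMatrix] using this.symm

/-- The Hilbert-Schmidt probability measure on two-qubit density matrices `ρ = I/4 + x`: the
Euclidean volume on the 15-dimensional space of the `x`, restricted to the set of density matrices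
and normalized. (Scaling the metric by a constant, as in `½ Tr (dρ)²`, does not change it.) -/
def hsMeasure : Measure TracelessHermitian :=
  ProbabilityTheory.cond (measureSpaceOfInnerProductSpace (E := TracelessHermitian)).volume
    {x | IsDensityMatrix (stateOf x)}

/-- Determinants of Hermitian matrices are real, so that nothing is lost by taking real parts of
`|ρ|` and, with `isHermitian_partialTranspose`, of `|ρ^PT|`. -/
theorem det_im_eq_zero {ρ : Matrix TwoQubit TwoQubit ℂ} (h : ρ.IsHermitian) : ρ.det.im = 0 := by
  have : star ρ.det = ρ.det := by rw [← Matrix.det_conjTranspose, h.eq]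
  exact Complex.conj_eq_iff_im.mp this

theorem isHermitian_partialTranspose {ρ : Matrix TwoQubit TwoQubit ℂ} (h : ρ.IsHermitian) :
    (partialTranspose ρ).IsHermitian := by
  ext i j
  exact h.apply _ _

/-- The random variable `|ρ|^k |ρ^PT|^n`. -/
def detProduct (k n : ℕ) (x : TracelessHermitian) : ℝ :=
  (stateOf x).det.re ^ k * (partialTranspose (stateOf x)).det.re ^ n

/-- The expectation `⟨|ρ|^k |ρ^PT|^n⟩` under Hilbert-Schmidt measure. -/
def hsMoment (k n : ℕ) : ℝ :=
  ∫ x, detProduct k n x ∂hsMeasure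

/-- The two-qubit numerator polynomials, for `n = 1, 2, 3, 4` (other values of `n` are not
used). -/
def qubitNumerator : ℕ → ℝ[X]
  | 1 => X ^ 3 + 6 * X ^ 2 - X - 42
  | 2 => X ^ 6 + 15 * X ^ 5 + 67 * X ^ 4 + 45 * X ^ 3 + 220 * X ^ 2 + 4260 * X + 10944
  | 3 => X ^ 9 + 27 * X ^ 8 + 282 * X ^ 7 + 1458 * X ^ 6 + 5373 * X ^ 5 + 27783 * X ^ 4
      + 80168 * X ^ 3 - 456948 * X ^ 2 - 3684384 * X - 6929280
  | 4 => X ^ 12 + 42 * X ^ 11 + 749 * X ^ 10 + 7542 * X ^ 9 + 50991 * X ^ 8 + 278478 * X ^ 7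
      + 1160375 * X ^ 6 + 1080858 * X ^ 5 - 13235252 * X ^ 4 + 64072440 * X ^ 3
      + 1342859616 * X ^ 2 + 6039653760 * X + 9247219200
  | _ => 0

/-- The two-qubit denominator `2^(6n) (k + 9/2)_n (2k + 17/2)_(2n)`, with the Pochhammer symbol
`(x)_n = x (x + 1) ⋯ (x + n - 1)`. -/
def qubitDenominator (n k : ℕ) : ℝ :=
  2 ^ (6 * n) * (ascPochhammer ℝ n).eval ((k : ℝ) + 9 / 2)
    * (ascPochhammer ℝ (2 * n)).eval (2 * (k : ℝ) + 17 / 2)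

end

/-! The moments are computed on the cone of positive semidefinite $W$ with weight
$e^{-\operatorname{tr} W}$. Both determinants are homogeneous of degree 4 and the slices of constant
trace have dimension 15, so integrating along rays turns a degree $4(k+n)$ integrand on density
matrices into the same integrand on the cone, up to the factor $(15+4(k+n))!$ and a constant
independent of $k$ and $n$ (`integral_wishartIntegrand_coneEquiv`, `exists_hsMoment_eq`). Expanding
$|W^{PT}|^n=((|W^{PT}|-|W|)+|W|)^n$ leaves the integrals of $|W|^k(|W^{PT}|-|W|)^j
e^{-\operatorname{tr}W}$ with $j\le 4$.

Write $W$ in blocks $A,C,B$. A unitary on the second qubit conjugates all blocks at once and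
preserves both determinants, so $A$ may be taken to be $D=\operatorname{diag}(a,b)$. With Schur
complement $S=B-C^*D^{-1}C$ one has $|W|=ab\,|S|$ and $|W^{PT}|=ab\,|S+N|$, where
$N=C^*D^{-1}C-CD^{-1}C^*$. Its diagonal is $(-g/b,\,g/a)$ with $g=|C_{12}|^2-|C_{21}|^2$, and its
off-diagonal entry is $h$ = `commEntry`. Hence $|S+N|-|S|$ is affine in $S$
(`det_partialTranspose_stateMatrix_diagonal`), while the weight splits into a Wishart weight for $S$
and a Gaussian weight for $C$ (`wishartIntegrand_diagonal`).

All remaining integrals are elementary: those over $S$ reduce to Beta and Gamma integrals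
(`integral_hermWeight_mul`), those over $C$ to complex Gaussian moments
(`integral_blockGaussian_mul`). The result is symmetric in $a,b$, hence a polynomial in
$\operatorname{tr}A$ and $|A|$, and the integral over $A$ is again of Wishart type
(`integral_wishartIntegrand`). Finally $(15+4(k+n))!/(15+4k)!=(k+4)_n\hat B_n(k)$, and $(k+4)_n$
cancels against the numerator. -/

/-! ### Integrability and radial integrals over the complex plane -/

open scoped Nat in
/-- A function on a finite-dimensional space that decays exponentially in a quantity dominating the
norm is integrable. -/
theorem integrable_of_exp_decay {E : Type*} [NormedAddCommGroup E] [NormedSpace ℝ E]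
    [FiniteDimensional ℝ E] [MeasurableSpace E] [BorelSpace E] {μ : Measure E}
    [μ.IsAddHaarMeasure] {f : E → ℝ} (hf : AEStronglyMeasurable f μ) (C : ℝ) (N : ℕ)
    (h : ∀ x, f x = 0 ∨ ∃ t : ℝ, ‖x‖ ≤ t ∧ |f x| ≤ C * (1 + t) ^ N * Real.exp (-t)) :
    Integrable f μ := by
  -- One more than the dimension is the least integer for which $(1+\|x\|)^{-r}$ is integrable.
  set r : ℕ := Module.finrank ℝ E + 1 with hr
  have hint : Integrable (fun x : E => (1 + ‖x‖) ^ (-(r : ℝ))) μ :=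
    integrable_one_add_norm (by rw [hr]; push_cast; linarith)
  refine Integrable.mono' (hint.const_mul (|C| * ((N + r)! * Real.exp 1))) hf
    (Filter.Eventually.of_forall fun x => ?_)
  rw [Real.norm_eq_abs]
  have h0 : 0 ≤ (1 + ‖x‖) ^ (-(r : ℝ)) := by positivity
  rcases h x with h | ⟨t, hxt, h⟩
  · rw [h, abs_zero]; positivity
  · have hx := norm_nonneg x
    have ht : 0 ≤ 1 + t := by linarith
    -- A single term of the series of $e^{1+t}$ absorbs both the factor $(1+t)^N$ and the comparison
    -- power $(1+\|x\|)^r$.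
    have h1 := Real.pow_div_factorial_le_exp _ ht (N + r)
    rw [div_le_iff₀ (by positivity), pow_add, Real.exp_add] at h1
    have h2 : (1 + ‖x‖) ^ r ≤ (1 + t) ^ r := by gcongr
    have h3 : (1 + t) ^ N * (1 + ‖x‖) ^ r ≤ (N + r)! * Real.exp 1 * Real.exp t := by
      calc (1 + t) ^ N * (1 + ‖x‖) ^ r ≤ (1 + t) ^ N * (1 + t) ^ r := by gcongr
        _ ≤ _ := by linarith
    rw [Real.rpow_neg (by positivity), Real.rpow_natCast, ← div_eq_mul_inv,
      le_div_iff₀ (by positivity)]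
    calc |f x| * (1 + ‖x‖) ^ r ≤ (|C| * (1 + t) ^ N * Real.exp (-t)) * (1 + ‖x‖) ^ r := by
          gcongr
          refine h.trans ?_
          gcongr
          exact le_abs_self C
      _ = |C| * ((1 + t) ^ N * (1 + ‖x‖) ^ r) * Real.exp (-t) := by ring
      _ ≤ |C| * ((N + r)! * Real.exp 1 * Real.exp t) * Real.exp (-t) := by gcongr
      _ = |C| * ((N + r)! * Real.exp 1) * (Real.exp t * Real.exp (-t)) := by ring
      _ = _ := by rw [← Real.exp_add]; simp

instance isAddHaarMeasure_volume_prod {E F : Type*} [AddGroup E] [TopologicalSpace E] [AddGroup F]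
    [TopologicalSpace F] [MeasureSpace E] [MeasureSpace F]
    [(volume : Measure E).IsAddHaarMeasure] [(volume : Measure F).IsAddHaarMeasure]
    [SFinite (volume : Measure E)] [SFinite (volume : Measure F)] [MeasurableAdd E]
    [MeasurableAdd F] : (volume : Measure (E × F)).IsAddHaarMeasure :=
  inferInstanceAs ((volume : Measure E).prod (volume : Measure F)).IsAddHaarMeasure

/-- A monomial `z ^ a * conj z ^ b` with `a ≠ b` has vanishing integral against a radial weight. -/
theorem integral_radial_mul_pow_mul_conj_pow (f : ℝ → ℝ) {a b : ℕ} (hab : a ≠ b) :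
    ∫ z : ℂ, (f ‖z‖ : ℂ) * (z ^ a * (starRingEnd ℂ z) ^ b) = 0 := by
  -- Rotation by this angle multiplies the monomial by $e^{i\theta(a-b)}=-1$, so the integral equals
  -- its own negative.
  set θ : ℝ := Real.pi / ((a : ℝ) - b) with hθ
  have hab' : ((a : ℝ) - b) ≠ 0 := sub_ne_zero.mpr (by exact_mod_cast hab)
  have hu : Circle.exp θ ^ a * (Circle.exp θ)⁻¹ ^ b = Circle.exp Real.pi := by
    rw [← Circle.exp_neg, ← Circle.exp_nsmul, ← Circle.exp_nsmul, ← Circle.exp_add]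
    congr 1
    rw [hθ]; simp only [nsmul_eq_mul]; field_simp; ring
  have hu' : (Circle.exp θ : ℂ) ^ a * (starRingEnd ℂ (Circle.exp θ : ℂ)) ^ b = -1 := by
    have := congrArg (fun z : Circle => (z : ℂ)) hu
    rw [← Circle.coe_inv_eq_conj, ← Circle.coe_pow, ← Circle.coe_pow, ← Circle.coe_mul, this]
    simp
  have h := (rotation (Circle.exp θ)).measurePreserving.integral_comp
    (rotation (Circle.exp θ)).toHomeomorph.measurableEmbedding
    (fun z : ℂ => (f ‖z‖ : ℂ) * (z ^ a * (starRingEnd ℂ z) ^ b))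
  have h2 : ∀ z : ℂ, (f ‖rotation (Circle.exp θ) z‖ : ℂ) * ((rotation (Circle.exp θ) z) ^ a *
      (starRingEnd ℂ (rotation (Circle.exp θ) z)) ^ b) =
      -((f ‖z‖ : ℂ) * (z ^ a * (starRingEnd ℂ z) ^ b)) := by
    intro z
    rw [LinearIsometryEquiv.norm_map, rotation_apply, map_mul, mul_pow, mul_pow]
    linear_combination ((f ‖z‖ : ℂ) * (z ^ a * (starRingEnd ℂ z) ^ b)) * hu'
  simp only [h2, integral_neg] at h
  exact self_eq_neg.mp h.symm

theorem integrable_radial_mul_pow_mul_conj_pow {f : ℝ → ℝ}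
    (hf : ∀ n : ℕ, Integrable fun z : ℂ => f ‖z‖ * ‖z‖ ^ n) (a b : ℕ) :
    Integrable fun z : ℂ => (f ‖z‖ : ℂ) * (z ^ a * (starRingEnd ℂ z) ^ b) := by
  have h0 : AEStronglyMeasurable (fun z : ℂ => f ‖z‖) := by simpa using (hf 0).1
  refine (hf (a + b)).mono ?_ (Filter.Eventually.of_forall fun z => ?_)
  · exact (Complex.continuous_ofReal.comp_aestronglyMeasurable h0).mul
      (Continuous.aestronglyMeasurable (by fun_prop))
  · simp [pow_add]

/-- Moments of `U + 2 Re (z conj w)` against a radial weight. -/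
theorem integral_radial_mul_add_two_re_pow {f : ℝ → ℝ}
    (hf : ∀ n : ℕ, Integrable fun z : ℂ => f ‖z‖ * ‖z‖ ^ n) (U : ℝ) (w : ℂ) (j : ℕ) :
    ∫ z : ℂ, f ‖z‖ * (U + 2 * (z * starRingEnd ℂ w).re) ^ j =
      ∑ m ∈ Finset.range (j + 1), if m % 2 = 0 then
        (j.choose m * m.choose (m / 2) : ℝ) * U ^ (j - m) * ‖w‖ ^ m *
          ∫ z : ℂ, f ‖z‖ * ‖z‖ ^ m else 0 := by
  have key : ∀ z : ℂ, ((f ‖z‖ * (U + 2 * (z * starRingEnd ℂ w).re) ^ j : ℝ) : ℂ) =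
      ∑ m ∈ Finset.range (j + 1), ∑ i ∈ Finset.range (m + 1),
        ((j.choose m * m.choose i : ℂ) * U ^ (j - m) *
          (starRingEnd ℂ w ^ i * w ^ (m - i))) *
          ((f ‖z‖ : ℂ) * (z ^ i * (starRingEnd ℂ z) ^ (m - i))) := by
    intro z
    have h1 : ((2 * (z * starRingEnd ℂ w).re : ℝ) : ℂ) =
        z * starRingEnd ℂ w + starRingEnd ℂ z * w := by
      rw [← Complex.add_conj]; simp
    push_cast at h1 ⊢
    rw [h1, add_comm, add_pow, Finset.mul_sum]
    refine Finset.sum_congr rfl fun m _ => ?_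
    rw [add_pow, Finset.sum_mul, Finset.sum_mul, Finset.mul_sum]
    refine Finset.sum_congr rfl fun i _ => ?_
    rw [mul_pow, mul_pow]; ring
  have hI := integrable_radial_mul_pow_mul_conj_pow hf
  rw [← Complex.ofReal_inj, ← integral_complex_ofReal]
  simp only [key]
  rw [integral_finsetSum _ fun m _ => integrable_finsetSum _ fun i _ => (hI _ _).const_mul _]
  push_cast
  refine Finset.sum_congr rfl fun m _ => ?_
  rw [integral_finsetSum _ fun i _ => (hI _ _).const_mul _]
  simp only [integral_const_mul]
  -- Only equal powers of $z$ and $\bar z$ survive: for even $m$ this leaves $i=m/2$, for odd $m$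
  -- nothing.
  split_ifs with hm
  · rw [Finset.sum_eq_single (m / 2)]
    · have hm2 : m - m / 2 = m / 2 := by omega
      have h3 : ∀ z : ℂ, z ^ (m / 2) * (starRingEnd ℂ z) ^ (m / 2) = ((‖z‖ ^ m : ℝ) : ℂ) := by
        intro z
        rw [← mul_pow, Complex.mul_conj']
        push_cast
        rw [← pow_mul]; congr 1; omega
      rw [hm2, mul_comm (starRingEnd ℂ w ^ (m / 2)), h3 w]
      simp only [h3]
      push_cast
      congr 1
      rw [← integral_complex_ofReal]
      push_cast
      rfl
    · intro i hi hne
      rw [integral_radial_mul_pow_mul_conj_pow f (by omega), mul_zero]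
    · intro h; exact absurd (Finset.mem_range.mpr (by omega)) h
  · push_cast
    refine Finset.sum_eq_zero fun i hi => ?_
    rw [integral_radial_mul_pow_mul_conj_pow f (by omega), mul_zero]

/-- Even moments of `‖z p - q‖` against a radial weight. -/
theorem integral_radial_mul_norm_sub_pow {f : ℝ → ℝ}
    (hf : ∀ n : ℕ, Integrable fun z : ℂ => f ‖z‖ * ‖z‖ ^ n) (p q : ℂ) (l : ℕ) :
    ∫ z : ℂ, f ‖z‖ * ‖z * p - q‖ ^ (2 * l) =
      ∑ m ∈ Finset.range (l + 1), (l.choose m : ℝ) ^ 2 * ‖p‖ ^ (2 * m) * ‖q‖ ^ (2 * (l - m)) *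
        ∫ z : ℂ, f ‖z‖ * ‖z‖ ^ (2 * m) := by
  have hsq : ∀ (z : ℂ) (n : ℕ), z ^ n * (starRingEnd ℂ z) ^ n = ((‖z‖ ^ (2 * n) : ℝ) : ℂ) := by
    intro z n
    rw [← mul_pow, Complex.mul_conj']
    push_cast
    rw [← pow_mul]
  have key : ∀ z : ℂ, ((f ‖z‖ * ‖z * p - q‖ ^ (2 * l) : ℝ) : ℂ) =
      ∑ m ∈ Finset.range (l + 1), ∑ i ∈ Finset.range (l + 1),
        ((l.choose m * l.choose i : ℂ) * ((p ^ m * (-q) ^ (l - m)) *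
          ((starRingEnd ℂ p) ^ i * (-starRingEnd ℂ q) ^ (l - i)))) *
          ((f ‖z‖ : ℂ) * (z ^ m * (starRingEnd ℂ z) ^ i)) := by
    intro z
    rw [Complex.ofReal_mul, ← hsq, sub_eq_add_neg, map_add, add_pow, add_pow, Finset.sum_mul_sum,
      Finset.mul_sum]
    refine Finset.sum_congr rfl fun m _ => ?_
    rw [Finset.mul_sum]
    refine Finset.sum_congr rfl fun i _ => ?_
    rw [map_mul, map_neg, mul_pow, mul_pow]; ring
  have hI := integrable_radial_mul_pow_mul_conj_pow hf
  rw [← Complex.ofReal_inj, ← integral_complex_ofReal]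
  simp only [key]
  rw [integral_finsetSum _ fun m _ => integrable_finsetSum _ fun i _ => (hI _ _).const_mul _]
  push_cast
  refine Finset.sum_congr rfl fun m hm => ?_
  rw [integral_finsetSum _ fun i _ => (hI _ _).const_mul _]
  simp only [integral_const_mul]
  -- The terms with $i\ne m$ have unequal powers of $z$ and $\bar z$ and vanish; hence the squared
  -- binomials.
  rw [Finset.sum_eq_single m]
  · simp only [hsq]
    have e1 := hsq p m
    have e2 := hsq q (l - m)
    have e3 : (-q) ^ (l - m) * (-starRingEnd ℂ q) ^ (l - m) =
        q ^ (l - m) * starRingEnd ℂ q ^ (l - m) := by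
      rw [← mul_pow, ← mul_pow]; ring
    have e4 : (∫ z : ℂ, (f ‖z‖ : ℂ) * ((‖z‖ ^ (2 * m) : ℝ) : ℂ)) =
        ((∫ z : ℂ, f ‖z‖ * ‖z‖ ^ (2 * m) : ℝ) : ℂ) := by
      rw [← integral_complex_ofReal]; push_cast; rfl
    rw [e4]
    push_cast at e1 e2 ⊢
    rw [← e1, ← e2]
    linear_combination ((l.choose m : ℂ) ^ 2 * p ^ m * starRingEnd ℂ p ^ m) * e3 *
      ((∫ z : ℂ, f ‖z‖ * ‖z‖ ^ (2 * m) : ℝ) : ℂ)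
  · intro i hi hne
    rw [integral_radial_mul_pow_mul_conj_pow f hne.symm, mul_zero]
  · intro h; exact absurd hm h

/-- Polar coordinates; the constant $2\pi$ is the dimension times the area of the unit disc. -/
theorem integral_radial_pow {f : ℝ → ℝ} (n : ℕ) :
    ∫ z : ℂ, f ‖z‖ * ‖z‖ ^ n = 2 * Real.pi * ∫ r in Set.Ioi (0 : ℝ), r * (f r * r ^ n) := by
  have h := integral_fun_norm_addHaar (volume : Measure ℂ) (fun r => f r * r ^ n)
  rw [h, Complex.finrank_real_complex]
  simp [Measure.real, Complex.volume_ball, mul_assoc]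

theorem integrable_gaussian_mul_norm_pow {c : ℝ} (hc : 0 < c) (n : ℕ) :
    Integrable fun z : ℂ => Real.exp (-(‖z‖ ^ 2 / c)) * ‖z‖ ^ n := by
  refine integrable_of_exp_decay (Continuous.aestronglyMeasurable (by fun_prop))
    (Real.exp (c / 4)) n fun z => Or.inr ⟨‖z‖, le_rfl, ?_⟩
  have hz := norm_nonneg z
  rw [abs_of_nonneg (by positivity)]
  have h1 : -(‖z‖ ^ 2 / c) ≤ c / 4 + -‖z‖ := by
    have : 0 ≤ (‖z‖ - c / 2) ^ 2 / c := by positivity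
    have e : (‖z‖ - c / 2) ^ 2 / c = ‖z‖ ^ 2 / c - ‖z‖ + c / 4 := by field_simp; ring
    linarith
  calc Real.exp (-(‖z‖ ^ 2 / c)) * ‖z‖ ^ n ≤ Real.exp (c / 4 + -‖z‖) * (1 + ‖z‖) ^ n := by
        gcongr; linarith
    _ = _ := by rw [Real.exp_add]; ring

open scoped Nat in
theorem integral_gaussian_mul_norm_pow {c : ℝ} (hc : 0 < c) (m : ℕ) :
    ∫ z : ℂ, Real.exp (-(‖z‖ ^ 2 / c)) * ‖z‖ ^ (2 * m) = Real.pi * m ! * c ^ (m + 1) := by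
  have h := Complex.integral_rpow_mul_exp_neg_mul_rpow (p := 2) (q := (2 * m : ℕ)) (b := 1 / c)
    (by norm_num) (by have : (0 : ℝ) ≤ (2 * m : ℕ) := by positivity
                      linarith) (by positivity)
  have e1 : (((2 * m : ℕ) : ℝ) + 2) / 2 = (m : ℝ) + 1 := by push_cast; ring
  have e2 : -(((2 * m : ℕ) : ℝ) + 2) / 2 = -((m + 1 : ℕ) : ℝ) := by push_cast; ring
  rw [e1, e2, Real.Gamma_nat_eq_factorial, Real.rpow_neg (by positivity), Real.rpow_natCast] at h
  calc _ = ∫ z : ℂ, ‖z‖ ^ ((2 * m : ℕ) : ℝ) * Real.exp (-(1 / c) * ‖z‖ ^ (2 : ℝ)) := by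
        congr 1; ext z
        rw [Real.rpow_natCast, Real.rpow_two, mul_comm]; congr 2; ring
    _ = _ := by
        rw [h, one_div, inv_pow, inv_inv]; ring

open scoped Nat in
-- A Beta integral. Integration by parts moves one power from $t$ to $R-t$, so the induction on $c$
-- needs $k$ general.
theorem integral_pow_mul_sub_pow {R : ℝ} (c k : ℕ) :
    ∫ t in (0 : ℝ)..R, t ^ c * (R - t) ^ k =
      (c ! * k ! : ℝ) / (k + c + 1)! * R ^ (k + c + 1) := by
  induction c generalizing k with
  | zero =>
    simp only [pow_zero, one_mul]
    rw [intervalIntegral.integral_comp_sub_left (fun t => t ^ k), integral_pow]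
    simp [Nat.factorial_succ]
    field_simp
  | succ c ih =>
    have hu : ∀ t ∈ Set.uIcc 0 R, HasDerivAt (fun t : ℝ => t ^ (c + 1))
        ((c + 1 : ℝ) * t ^ c) t := by
      intro t _; simpa using hasDerivAt_pow (c + 1) t
    have hv : ∀ t ∈ Set.uIcc 0 R, HasDerivAt (fun t : ℝ => -(R - t) ^ (k + 1) / (k + 1 : ℝ))
        ((R - t) ^ k) t := by
      intro t _
      have := (((hasDerivAt_id t).const_sub R).pow (k + 1)).neg.div_const (k + 1 : ℝ)
      convert! this using 1
      field_simp
      simp [mul_comm]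
    rw [intervalIntegral.integral_mul_deriv_eq_deriv_mul hu hv
      (Continuous.intervalIntegrable (by fun_prop) _ _)
      (Continuous.intervalIntegrable (by fun_prop) _ _)]
    have e : ∀ t : ℝ, (c + 1 : ℝ) * t ^ c * (-(R - t) ^ (k + 1) / (k + 1 : ℝ)) =
        -((c + 1 : ℝ) / (k + 1)) * (t ^ c * (R - t) ^ (k + 1)) := by intro t; ring
    simp only [e]
    rw [intervalIntegral.integral_const_mul, ih (k + 1)]
    have e3 : k + 1 + c + 1 = k + (c + 1) + 1 := by ring
    rw [e3]
    simp only [sub_self, Nat.factorial_succ c, Nat.factorial_succ k]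
    push_cast
    field_simp
    ring

/-- The radial profile of `(R - |z|²) ^ k` on the disc `|z|² ≤ R`. -/
noncomputable def discProfile (R : ℝ) (k : ℕ) (r : ℝ) : ℝ :=
  if r ^ 2 ≤ R then (R - r ^ 2) ^ k else 0

theorem measurable_discProfile (R : ℝ) (k : ℕ) : Measurable (discProfile R k) :=
  Measurable.ite (measurableSet_le (by fun_prop) (by fun_prop)) (by fun_prop) (by fun_prop)

theorem integrable_discProfile_mul_norm_pow (R : ℝ) (k n : ℕ) :
    Integrable fun z : ℂ => discProfile R k ‖z‖ * ‖z‖ ^ n := by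
  refine integrable_of_exp_decay (((measurable_discProfile R k).comp measurable_norm).mul
    (by fun_prop)).aestronglyMeasurable (R ^ k * Real.exp (1 + R)) n fun z => ?_
  have hz := norm_nonneg z
  by_cases h : ‖z‖ ^ 2 ≤ R
  · refine Or.inr ⟨‖z‖, le_rfl, ?_⟩
    have hR : 0 ≤ R := (sq_nonneg _).trans h
    have h1 : ‖z‖ ≤ 1 + R := by nlinarith
    have h2 : 0 ≤ R - ‖z‖ ^ 2 := by linarith
    rw [discProfile, if_pos h, abs_of_nonneg (by positivity)]
    have h3 : 1 ≤ Real.exp (1 + R) * Real.exp (-‖z‖) := by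
      rw [← Real.exp_add]; exact Real.one_le_exp (by linarith)
    calc (R - ‖z‖ ^ 2) ^ k * ‖z‖ ^ n ≤ R ^ k * (1 + ‖z‖) ^ n * 1 := by
          rw [mul_one]; gcongr
          · linarith [sq_nonneg ‖z‖]
          · linarith
      _ ≤ R ^ k * (1 + ‖z‖) ^ n * (Real.exp (1 + R) * Real.exp (-‖z‖)) := by gcongr
      _ = _ := by ring
  · left; simp [discProfile, h]

open scoped Nat in
-- In polar coordinates the substitution $t=r^2$ turns this into the Beta integral.
theorem integral_discProfile_mul_norm_pow {R : ℝ} (hR : 0 ≤ R) (k c : ℕ) :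
    ∫ z : ℂ, discProfile R k ‖z‖ * ‖z‖ ^ (2 * c) =
      Real.pi * ((c ! * k ! : ℝ) / (k + c + 1)! * R ^ (k + c + 1)) := by
  rw [integral_radial_pow, ← integral_pow_mul_sub_pow c k]
  have h1 : ∫ r in Set.Ioi (0 : ℝ), r * (discProfile R k r * r ^ (2 * c)) =
      ∫ r in Set.Ioc 0 (√R), r * ((R - r ^ 2) ^ k * r ^ (2 * c)) := by
    rw [← integral_indicator measurableSet_Ioi, ← integral_indicator measurableSet_Ioc]
    congr 1; ext r
    by_cases hr : 0 < r
    · have : r ≤ √R ↔ r ^ 2 ≤ R := Real.le_sqrt hr.le hR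
      by_cases h2 : r ^ 2 ≤ R
      · rw [Set.indicator_of_mem (by exact hr), Set.indicator_of_mem (Set.mem_Ioc.mpr ⟨hr,
          this.mpr h2⟩),
          discProfile, if_pos h2]
      · rw [Set.indicator_of_mem (by exact hr), Set.indicator_of_notMem, discProfile, if_neg h2]
        · simp
        · exact fun h => h2 (this.mp h.2)
    · rw [Set.indicator_of_notMem (by exact hr), Set.indicator_of_notMem fun h => hr h.1]
  rw [h1, ← intervalIntegral.integral_of_le (Real.sqrt_nonneg R)]
  have h2 := intervalIntegral.integral_comp_mul_deriv (a := 0) (b := √R) (f := fun r : ℝ => r ^ 2)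
    (f' := fun r => 2 * r) (g := fun t => t ^ c * (R - t) ^ k)
    (fun r _ => by simpa using hasDerivAt_pow 2 r) (by fun_prop) (by fun_prop)
  simp only [Function.comp_apply, Real.sq_sqrt hR] at h2
  rw [zero_pow two_ne_zero] at h2
  rw [← h2, mul_comm 2 Real.pi, mul_assoc, ← intervalIntegral.integral_const_mul]
  congr 2
  ext r
  rw [pow_mul]; ring

/-! ### Gamma integrals -/

/-- The density of the Gamma distribution, up to normalization. -/
noncomputable def gammaWeight (n : ℕ) (s : ℝ) : ℝ := if 0 ≤ s then s ^ n * Real.exp (-s) else 0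

theorem integrable_gammaWeight (n : ℕ) : Integrable (gammaWeight n) := by
  refine integrable_of_exp_decay (Measurable.ite (measurableSet_le (by fun_prop) (by fun_prop))
    (by fun_prop) (by fun_prop)).aestronglyMeasurable 1 n fun s => ?_
  by_cases hs : 0 ≤ s
  · refine Or.inr ⟨s, by rw [Real.norm_of_nonneg hs], ?_⟩
    rw [gammaWeight, if_pos hs, abs_of_nonneg (by positivity), one_mul]
    gcongr; linarith
  · left; rw [gammaWeight, if_neg hs]

open scoped Nat in
theorem integral_gammaWeight (n : ℕ) : ∫ s, gammaWeight n s = n ! := by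
  have h := Real.integral_rpow_mul_exp_neg_mul_Ioi (a := n + 1) (r := 1) (by positivity) one_pos
  rw [Real.Gamma_nat_eq_factorial] at h
  simp only [div_one, Real.one_rpow, one_mul, add_sub_cancel_right, Real.rpow_natCast] at h
  rw [← h, ← integral_Ici_eq_integral_Ioi, ← integral_indicator measurableSet_Ici]
  rfl

open scoped Nat in
/-- The sum giving the integral of `(a b) ^ n (x a + y b + r) ^ i` against `exp (-a - b)`. -/
noncomputable def gammaSum (n i : ℕ) (x y r : ℝ) : ℝ :=
  ∑ u ∈ Finset.range (i + 1), ∑ v ∈ Finset.range (i - u + 1),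
    (i.choose u * (i - u).choose v : ℝ) * x ^ u * y ^ v * r ^ (i - u - v) * ((n + u)! * (n + v)!)

/-- A power of a variable is absorbed by raising the index of its Gamma weight, so the multinomial
expansion separates the two variables. -/
theorem gammaWeight_prod_expand (n i : ℕ) (x y r : ℝ) (p : ℝ × ℝ) :
    gammaWeight n p.1 * gammaWeight n p.2 * (x * p.1 + y * p.2 + r) ^ i =
      ∑ u ∈ Finset.range (i + 1), ∑ v ∈ Finset.range (i - u + 1),
        ((i.choose u * (i - u).choose v : ℝ) * x ^ u * y ^ v * r ^ (i - u - v)) *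
          (gammaWeight (n + u) p.1 * gammaWeight (n + v) p.2) := by
  unfold gammaWeight
  split_ifs with h1 h2
  · rw [add_assoc, add_pow, Finset.mul_sum]
    refine Finset.sum_congr rfl fun u _ => ?_
    rw [add_pow, Finset.mul_sum, Finset.sum_mul, Finset.mul_sum]
    refine Finset.sum_congr rfl fun v _ => ?_
    rw [mul_pow, mul_pow, pow_add, pow_add]; ring
  all_goals simp

theorem integrable_gammaWeight_prod (n i : ℕ) (x y r : ℝ) :
    Integrable fun p : ℝ × ℝ =>
      gammaWeight n p.1 * gammaWeight n p.2 * (x * p.1 + y * p.2 + r) ^ i := by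
  simp only [gammaWeight_prod_expand]
  exact integrable_finsetSum _ fun u _ => integrable_finsetSum _ fun v _ =>
    ((integrable_gammaWeight _).mul_prod (integrable_gammaWeight _)).const_mul _

theorem integral_gammaWeight_prod (n i : ℕ) (x y r : ℝ) :
    ∫ p : ℝ × ℝ, gammaWeight n p.1 * gammaWeight n p.2 * (x * p.1 + y * p.2 + r) ^ i =
      gammaSum n i x y r := by
  have hI : ∀ a b : ℕ, Integrable fun p : ℝ × ℝ => gammaWeight a p.1 * gammaWeight b p.2 :=
    fun a b => (integrable_gammaWeight a).mul_prod (integrable_gammaWeight b)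
  simp only [gammaWeight_prod_expand]
  rw [integral_finsetSum _ fun u _ => integrable_finsetSum _ fun v _ => (hI _ _).const_mul _,
    gammaSum]
  refine Finset.sum_congr rfl fun u _ => ?_
  rw [integral_finsetSum _ fun v _ => (hI _ _).const_mul _]
  refine Finset.sum_congr rfl fun v _ => ?_
  rw [integral_const_mul, Measure.volume_eq_prod, integral_prod_mul, integral_gammaWeight,
    integral_gammaWeight]

/-! ### Moments of affine forms under the Wishart weight on 2 × 2 Hermitian matrices -/

/-- Real coordinates of `2 × 2` Hermitian matrices: the diagonal,
and the upper off-diagonal entry. -/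
abbrev HermCoord : Type := (ℝ × ℝ) × ℂ

/-- Positive semidefiniteness of a `2 × 2` Hermitian matrix, in coordinates. -/
def hermCone : Set HermCoord := {p | 0 ≤ p.1.1 ∧ 0 ≤ p.1.2 ∧ ‖p.2‖ ^ 2 ≤ p.1.1 * p.1.2}

theorem measurableSet_hermCone : MeasurableSet hermCone :=
  (measurableSet_le measurable_const (by fun_prop : Measurable fun p : HermCoord => p.1.1)).inter
    ((measurableSet_le measurable_const (by fun_prop : Measurable fun p : HermCoord => p.1.2)).inter
      (measurableSet_le (by fun_prop : Measurable fun p : HermCoord => ‖p.2‖ ^ 2)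
        (by fun_prop : Measurable fun p : HermCoord => p.1.1 * p.1.2)))

open Classical in
/-- The complex Wishart density on `2 × 2` Hermitian matrices, up to normalization. -/
noncomputable def hermWeight (k : ℕ) (p : HermCoord) : ℝ :=
  if p ∈ hermCone then (p.1.1 * p.1.2 - ‖p.2‖ ^ 2) ^ k * Real.exp (-(p.1.1 + p.1.2)) else 0

theorem measurable_hermWeight (k : ℕ) : Measurable (hermWeight k) :=
  Measurable.ite measurableSet_hermCone (by fun_prop) (by fun_prop)

/-- The trace dominates the norm on the cone, so the factor $e^{-\operatorname{tr}}$ is the decay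
required by `integrable_of_exp_decay`. -/
theorem norm_le_of_mem_hermCone {p : HermCoord} (hp : p ∈ hermCone) : ‖p‖ ≤ p.1.1 + p.1.2 := by
  obtain ⟨h1, h2, h3⟩ := hp
  refine max_le (max_le ?_ ?_) ?_
  · rw [Real.norm_of_nonneg h1]; linarith
  · rw [Real.norm_of_nonneg h2]; linarith
  · have := norm_nonneg p.2
    nlinarith

theorem integrable_hermWeight_mul (k j : ℕ) (x y r : ℝ) (w : ℂ) :
    Integrable fun p : HermCoord => hermWeight k p *
      (x * p.1.1 + y * p.1.2 + r + 2 * (p.2 * starRingEnd ℂ w).re) ^ j := by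
  refine integrable_of_exp_decay ((measurable_hermWeight k).mul
    (by fun_prop)).aestronglyMeasurable ((|x| + |y| + |r| + 2 * ‖w‖) ^ j) (2 * k + j) fun p => ?_
  by_cases hp : p ∈ hermCone
  · refine Or.inr ⟨p.1.1 + p.1.2, norm_le_of_mem_hermCone hp, ?_⟩
    have hz : ‖p.2‖ ≤ p.1.1 + p.1.2 := (norm_snd_le p).trans (norm_le_of_mem_hermCone hp)
    rw [hermWeight, if_pos hp]
    obtain ⟨h1, h2, h3⟩ := hp
    set t := p.1.1 + p.1.2 with ht
    have h4 : 0 ≤ p.1.1 * p.1.2 - ‖p.2‖ ^ 2 := by linarith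
    have h5 : p.1.1 * p.1.2 - ‖p.2‖ ^ 2 ≤ (1 + t) ^ 2 := by nlinarith [sq_nonneg ‖p.2‖]
    have h6 : |x * p.1.1 + y * p.1.2 + r + 2 * (p.2 * starRingEnd ℂ w).re| ≤
        (|x| + |y| + |r| + 2 * ‖w‖) * (1 + t) := by
      have e1 : |x * p.1.1| ≤ |x| * (1 + t) := by
        rw [abs_mul, abs_of_nonneg h1]; gcongr; linarith
      have e2 : |y * p.1.2| ≤ |y| * (1 + t) := by
        rw [abs_mul, abs_of_nonneg h2]; gcongr; linarith
      have e3 : |r| ≤ |r| * (1 + t) := le_mul_of_one_le_right (abs_nonneg r) (by linarith)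
      have e4 : |2 * (p.2 * starRingEnd ℂ w).re| ≤ 2 * ‖w‖ * (1 + t) := by
        rw [abs_mul, abs_of_pos two_pos, mul_assoc]
        gcongr
        refine (Complex.abs_re_le_norm _).trans ?_
        rw [norm_mul, RCLike.norm_conj, mul_comm]
        gcongr; linarith
      calc _ ≤ |x * p.1.1| + |y * p.1.2| + |r| + |2 * (p.2 * starRingEnd ℂ w).re| :=
            (abs_add_le _ _).trans (add_le_add_left ((abs_add_le _ _).trans
              (add_le_add_left (abs_add_le _ _) _)) _)
        _ ≤ _ := by linarith
    rw [abs_mul, abs_mul, abs_pow, abs_pow, abs_of_nonneg h4, abs_of_pos (Real.exp_pos _)]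
    calc _ ≤ ((1 + t) ^ 2) ^ k * Real.exp (-t) * ((|x| + |y| + |r| + 2 * ‖w‖) * (1 + t)) ^ j := by
          gcongr
      _ = _ := by rw [mul_pow, pow_add, pow_mul]; ring
  · left; rw [hermWeight, if_neg hp, zero_mul]

open scoped Nat in
/-- The sum giving the moments of a linear form against `hermWeight`. -/
noncomputable def hermSum (k j : ℕ) (x y r h : ℝ) : ℝ :=
  ∑ m ∈ Finset.range (j + 1), if m % 2 = 0 then
    (j.choose m * m.choose (m / 2) : ℝ) * h ^ (m / 2) *
      (((m / 2)! * k ! : ℝ) / (k + m / 2 + 1)!) * gammaSum (k + m / 2 + 1) (j - m) x y r else 0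

open scoped Nat in
-- For fixed nonnegative diagonal the off-diagonal entry runs over a disc of squared radius $q_1q_2$
-- with radial density. Its even moments contribute $(q_1q_2)^{k+m/2+1}$, which becomes the index of
-- the Gamma weights in the diagonal entries. If a diagonal entry is negative, both sides vanish.
theorem integral_hermWeight_slice (k j : ℕ) (x y r : ℝ) (w : ℂ) (q : ℝ × ℝ) :
    ∫ z : ℂ, hermWeight k (q, z) * (x * q.1 + y * q.2 + r + 2 * (z * starRingEnd ℂ w).re) ^ j =
      ∑ m ∈ Finset.range (j + 1), if m % 2 = 0 then
        ((j.choose m * m.choose (m / 2) : ℝ) * (‖w‖ ^ 2) ^ (m / 2) * Real.pi *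
          (((m / 2)! * k ! : ℝ) / (k + m / 2 + 1)!)) *
          (gammaWeight (k + m / 2 + 1) q.1 * gammaWeight (k + m / 2 + 1) q.2 *
            (x * q.1 + y * q.2 + r) ^ (j - m)) else 0 := by
  by_cases hq : 0 ≤ q.1 ∧ 0 ≤ q.2
  · have e : ∀ z : ℂ, hermWeight k (q, z) *
        (x * q.1 + y * q.2 + r + 2 * (z * starRingEnd ℂ w).re) ^ j =
        Real.exp (-(q.1 + q.2)) * (discProfile (q.1 * q.2) k ‖z‖ *
          ((x * q.1 + y * q.2 + r) + 2 * (z * starRingEnd ℂ w).re) ^ j) := by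
      intro z
      by_cases hz : ‖z‖ ^ 2 ≤ q.1 * q.2
      · rw [hermWeight, if_pos ⟨hq.1, hq.2, hz⟩, discProfile, if_pos hz]; ring
      · rw [hermWeight, if_neg fun h => hz h.2.2, discProfile, if_neg hz]; ring
    simp only [e]
    rw [integral_const_mul, integral_radial_mul_add_two_re_pow
      (integrable_discProfile_mul_norm_pow _ _), Finset.mul_sum]
    refine Finset.sum_congr rfl fun m _ => ?_
    split_ifs with hm
    · have hm2 : m = 2 * (m / 2) := by omega
      have e2 := integral_discProfile_mul_norm_pow (mul_nonneg hq.1 hq.2) k (m / 2)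
      rw [← hm2] at e2
      have e3 : ‖w‖ ^ m = (‖w‖ ^ 2) ^ (m / 2) := by rw [← pow_mul, ← hm2]
      rw [e2, e3, gammaWeight, gammaWeight, if_pos hq.1, if_pos hq.2, neg_add, Real.exp_add,
        mul_pow q.1]
      ring
    · simp
  · have e : ∀ z : ℂ, hermWeight k (q, z) = 0 := fun z => by
      rw [hermWeight, if_neg fun h => hq ⟨h.1, h.2.1⟩]
    simp only [e, zero_mul, integral_zero]
    refine (Finset.sum_eq_zero fun m _ => ?_).symm
    have : ∀ n, gammaWeight n q.1 * gammaWeight n q.2 = 0 := by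
      intro n
      rw [not_and_or] at hq
      rcases hq with h | h <;> simp [gammaWeight, h]
    simp [this]

theorem integral_hermWeight_mul (k j : ℕ) (x y r : ℝ) (w : ℂ) :
    ∫ p : HermCoord, hermWeight k p *
      (x * p.1.1 + y * p.1.2 + r + 2 * (p.2 * starRingEnd ℂ w).re) ^ j =
      Real.pi * hermSum k j x y r (‖w‖ ^ 2) := by
  rw [Measure.volume_eq_prod, integral_prod _ (integrable_hermWeight_mul k j x y r w)]
  simp only [integral_hermWeight_slice]
  rw [integral_finsetSum]
  · rw [hermSum, Finset.mul_sum]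
    refine Finset.sum_congr rfl fun m _ => ?_
    split_ifs
    · rw [integral_const_mul, integral_gammaWeight_prod]; ring
    · simp
  · intro m _
    split_ifs
    · exact (integrable_gammaWeight_prod _ _ _ _ _).const_mul _
    · simp

/-! ### Gaussian moments of the off-diagonal block -/

/-- The entries `(((C₁₁, C₂₂), C₂₁), C₁₂)` of a complex `2 × 2` matrix. -/
abbrev BlockCoord : Type := ((ℂ × ℂ) × ℂ) × ℂ

instance : (volume : Measure ((ℂ × ℂ) × ℂ)).IsAddHaarMeasure := isAddHaarMeasure_volume_prod

instance : (volume : Measure BlockCoord).IsAddHaarMeasure := isAddHaarMeasure_volume_prod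

/-- The Gaussian weight `exp (-tr (Cᴴ D⁻¹ C))`, for `D = diag(a, b)`. -/
noncomputable def blockGaussian (a b : ℝ) (c : BlockCoord) : ℝ :=
  Real.exp (-(‖c.1.1.1‖ ^ 2 / a)) * Real.exp (-(‖c.1.1.2‖ ^ 2 / b)) *
    Real.exp (-(‖c.1.2‖ ^ 2 / b)) * Real.exp (-(‖c.2‖ ^ 2 / a))

/-- The difference `|C₁₂|² - |C₂₁|²`. -/
noncomputable def offDiagGap (c : BlockCoord) : ℝ := ‖c.2‖ ^ 2 - ‖c.1.2‖ ^ 2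

/-- The difference `C₁₁ / a - C₂₂ / b`. -/
noncomputable def diagGap (a b : ℝ) (c : ℂ × ℂ) : ℂ := c.1 / a - c.2 / b

/-- The off-diagonal entry of `Cᴴ D⁻¹ C - C D⁻¹ Cᴴ`, for `D = diag(a, b)`. -/
noncomputable def commEntry (a b : ℝ) (c : BlockCoord) : ℂ :=
  c.2 * starRingEnd ℂ (diagGap a b c.1.1) - starRingEnd ℂ c.1.2 * diagGap a b c.1.1

/-- Completing the square, $(x-a/2)^2\ge 0$; this reduces Gaussian decay to the exponential decay
criterion. -/
theorem exp_neg_sq_div_le {a : ℝ} (ha : 0 < a) (x : ℝ) :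
    Real.exp (-(x ^ 2 / a)) ≤ Real.exp (a / 4) * Real.exp (-x) := by
  rw [← Real.exp_add]
  gcongr
  have : 0 ≤ (x - a / 2) ^ 2 / a := by positivity
  have e : (x - a / 2) ^ 2 / a = x ^ 2 / a - x + a / 4 := by field_simp; ring
  linarith

theorem norm_diagGap_le {a b : ℝ} (ha : 0 < a) (hb : 0 < b) (c : ℂ × ℂ) :
    ‖diagGap a b c‖ ≤ (1 / a + 1 / b) * (1 + (‖c.1‖ + ‖c.2‖)) := by
  have h1 := norm_nonneg c.1
  have h2 := norm_nonneg c.2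
  calc ‖diagGap a b c‖ ≤ ‖c.1 / a‖ + ‖c.2 / b‖ := norm_sub_le _ _
    _ = 1 / a * ‖c.1‖ + 1 / b * ‖c.2‖ := by
      rw [norm_div, norm_div, Complex.norm_real, Complex.norm_real, Real.norm_of_nonneg ha.le,
        Real.norm_of_nonneg hb.le]; ring
    _ ≤ 1 / a * (1 + (‖c.1‖ + ‖c.2‖)) + 1 / b * (1 + (‖c.1‖ + ‖c.2‖)) := by
      gcongr <;> linarith
    _ = _ := by ring

theorem integrable_diagGap_pow {a b : ℝ} (ha : 0 < a) (hb : 0 < b) (l : ℕ) :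
    Integrable fun c : ℂ × ℂ => Real.exp (-(‖c.1‖ ^ 2 / a)) * Real.exp (-(‖c.2‖ ^ 2 / b)) *
      ‖diagGap a b c‖ ^ l := by
  refine integrable_of_exp_decay (Continuous.aestronglyMeasurable (by unfold diagGap; fun_prop))
    (Real.exp (a / 4) * Real.exp (b / 4) * (1 / a + 1 / b) ^ l) l
    fun c => Or.inr ⟨‖c.1‖ + ‖c.2‖, ?_, ?_⟩
  · exact max_le (by linarith [norm_nonneg c.2]) (by linarith [norm_nonneg c.1])
  · rw [abs_of_nonneg (by positivity)]
    calc _ ≤ (Real.exp (a / 4) * Real.exp (-‖c.1‖)) * (Real.exp (b / 4) * Real.exp (-‖c.2‖)) *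
          ((1 / a + 1 / b) * (1 + (‖c.1‖ + ‖c.2‖))) ^ l := by
          gcongr
          · exact exp_neg_sq_div_le ha _
          · exact exp_neg_sq_div_le hb _
          · exact norm_diagGap_le ha hb c
      _ = _ := by rw [mul_pow, neg_add, Real.exp_add]; ring

theorem integrable_blockGaussian_mul {a b : ℝ} (ha : 0 < a) (hb : 0 < b) (i l : ℕ) :
    Integrable fun c : BlockCoord =>
      blockGaussian a b c * (offDiagGap c ^ i * ‖commEntry a b c‖ ^ (2 * l)) := by
  refine integrable_of_exp_decay (Continuous.aestronglyMeasurable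
    (by unfold blockGaussian offDiagGap commEntry diagGap; fun_prop))
    (Real.exp (a / 4) ^ 2 * Real.exp (b / 4) ^ 2 * 2 ^ i * (2 * (1 / a + 1 / b)) ^ (2 * l))
    (2 * i + 2 * (2 * l))
    fun c => Or.inr ⟨‖c.1.1.1‖ + ‖c.1.1.2‖ + ‖c.1.2‖ + ‖c.2‖, ?_, ?_⟩
  all_goals
    have h1 := norm_nonneg c.1.1.1
    have h2 := norm_nonneg c.1.1.2
    have h3 := norm_nonneg c.1.2
    have h4 := norm_nonneg c.2
  · exact max_le (max_le (max_le (by linarith) (by linarith)) (by linarith)) (by linarith)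
  · set t := ‖c.1.1.1‖ + ‖c.1.1.2‖ + ‖c.1.2‖ + ‖c.2‖ with ht
    have e1 : blockGaussian a b c ≤
        Real.exp (a / 4) ^ 2 * Real.exp (b / 4) ^ 2 * Real.exp (-t) := by
      calc blockGaussian a b c ≤ (Real.exp (a / 4) * Real.exp (-‖c.1.1.1‖)) *
            (Real.exp (b / 4) * Real.exp (-‖c.1.1.2‖)) *
            (Real.exp (b / 4) * Real.exp (-‖c.1.2‖)) *
            (Real.exp (a / 4) * Real.exp (-‖c.2‖)) := by
            unfold blockGaussian
            gcongr
            · exact exp_neg_sq_div_le ha _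
            · exact exp_neg_sq_div_le hb _
            · exact exp_neg_sq_div_le hb _
            · exact exp_neg_sq_div_le ha _
        _ = _ := by
          rw [ht, neg_add, neg_add, neg_add, Real.exp_add, Real.exp_add, Real.exp_add]; ring
    have e2 : |offDiagGap c| ≤ 2 * (1 + t) ^ 2 := by
      unfold offDiagGap
      have : ‖c.2‖ ≤ 1 + t := by linarith
      have : ‖c.1.2‖ ≤ 1 + t := by linarith
      rw [abs_le]; constructor <;> nlinarith
    have e3 : ‖commEntry a b c‖ ≤ 2 * (1 / a + 1 / b) * (1 + t) ^ 2 := by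
      have e4 : ‖diagGap a b c.1.1‖ ≤ (1 / a + 1 / b) * (1 + t) :=
        (norm_diagGap_le ha hb _).trans (by gcongr; linarith)
      calc ‖commEntry a b c‖ ≤ ‖c.2‖ * ‖diagGap a b c.1.1‖ + ‖c.1.2‖ * ‖diagGap a b c.1.1‖ := by
            refine (norm_sub_le _ _).trans (le_of_eq ?_)
            rw [norm_mul, norm_mul, RCLike.norm_conj, RCLike.norm_conj]
        _ ≤ (1 + t) * ((1 / a + 1 / b) * (1 + t)) + (1 + t) * ((1 / a + 1 / b) * (1 + t)) := by
            gcongr <;> linarith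
        _ = _ := by ring
    have e0 : 0 ≤ blockGaussian a b c := by unfold blockGaussian; positivity
    rw [abs_mul, abs_mul, abs_pow, abs_pow, abs_norm, abs_of_nonneg e0]
    calc _ ≤ (Real.exp (a / 4) ^ 2 * Real.exp (b / 4) ^ 2 * Real.exp (-t)) *
          ((2 * (1 + t) ^ 2) ^ i * (2 * (1 / a + 1 / b) * (1 + t) ^ 2) ^ (2 * l)) := by gcongr
      _ = _ := by
          rw [mul_pow, mul_pow _ ((1 + t) ^ 2), ← pow_mul, ← pow_mul, pow_add]; ring

open scoped Nat in
-- Under the normalized weight $C_{11}/a$ and $C_{22}/b$ are independent complex Gaussians of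
-- variances $1/a$ and $1/b$. Their difference is Gaussian of variance $1/a+1/b$, whose $2l$-th
-- absolute moment is $l!$ times the $l$-th power of the variance.
theorem integral_diagGap_pow {a b : ℝ} (ha : 0 < a) (hb : 0 < b) (l : ℕ) :
    ∫ c : ℂ × ℂ, Real.exp (-(‖c.1‖ ^ 2 / a)) * Real.exp (-(‖c.2‖ ^ 2 / b)) *
      ‖diagGap a b c‖ ^ (2 * l) =
      Real.pi ^ 2 * a * b * (l ! * (1 / a + 1 / b) ^ l) := by
  rw [Measure.volume_eq_prod, integral_prod _ (integrable_diagGap_pow ha hb (2 * l))]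
  have e : ∀ z : ℂ, ∫ w : ℂ, Real.exp (-(‖z‖ ^ 2 / a)) * Real.exp (-(‖w‖ ^ 2 / b)) *
      ‖diagGap a b (z, w)‖ ^ (2 * l) = ∑ m ∈ Finset.range (l + 1),
        ((l.choose m : ℝ) ^ 2 * (1 / b) ^ (2 * m) * (1 / a) ^ (2 * (l - m)) *
          (Real.pi * m ! * b ^ (m + 1))) *
          (Real.exp (-(‖z‖ ^ 2 / a)) * ‖z‖ ^ (2 * (l - m))) := by
    intro z
    have e1 : ∀ w : ℂ, Real.exp (-(‖z‖ ^ 2 / a)) * Real.exp (-(‖w‖ ^ 2 / b)) *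
        ‖diagGap a b (z, w)‖ ^ (2 * l) = Real.exp (-(‖z‖ ^ 2 / a)) *
          (Real.exp (-(‖w‖ ^ 2 / b)) * ‖w * (1 / b : ℝ) - z / a‖ ^ (2 * l)) := by
      intro w
      rw [diagGap, norm_sub_rev]
      push_cast
      rw [mul_one_div]; ring
    simp only [e1]
    rw [integral_const_mul,
      integral_radial_mul_norm_sub_pow (f := fun s => Real.exp (-(s ^ 2 / b)))
      (integrable_gaussian_mul_norm_pow hb), Finset.mul_sum]
    refine Finset.sum_congr rfl fun m _ => ?_
    rw [integral_gaussian_mul_norm_pow hb, norm_div, Complex.norm_real, Complex.norm_real,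
      Real.norm_of_nonneg ha.le, Real.norm_of_nonneg (by positivity), div_eq_mul_one_div ‖z‖,
      mul_pow ‖z‖]
    ring
  simp only [e]
  rw [integral_finsetSum _ fun m _ => (integrable_gaussian_mul_norm_pow ha _).const_mul _,
    add_comm (1 / a), add_pow, Finset.mul_sum, Finset.mul_sum]
  refine Finset.sum_congr rfl fun m hm => ?_
  have hm' : m ≤ l := Nat.lt_succ_iff.mp (Finset.mem_range.mp hm)
  rw [integral_const_mul, integral_gaussian_mul_norm_pow ha,
    ← Nat.choose_mul_factorial_mul_factorial hm']
  push_cast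
  have hb2 : (1 / b) ^ (2 * m) * b ^ (m + 1) = b * (1 / b) ^ m := by
    rw [one_div, inv_pow, inv_pow, two_mul, pow_add, pow_succ]; field_simp
  have ha2 : (1 / a) ^ (2 * (l - m)) * a ^ (l - m + 1) = a * (1 / a) ^ (l - m) := by
    rw [one_div, inv_pow, inv_pow, two_mul, pow_add, pow_succ]; field_simp
  linear_combination (l.choose m ^ 2 * (Real.pi * m ! * (Real.pi * (l - m)!))) *
    ((1 / a) ^ (2 * (l - m)) * a ^ (l - m + 1)) * hb2 +
    (l.choose m ^ 2 * (Real.pi * m ! * (Real.pi * (l - m)!))) * (b * (1 / b) ^ m) * ha2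

open scoped Nat in
/-- The normalized Gaussian moments of `offDiagGap ^ i * ‖commEntry‖ ^ (2 * l)`. -/
noncomputable def blockMoment (i l : ℕ) (a b : ℝ) : ℝ :=
  l ! * (1 / a + 1 / b) ^ l * ∑ m ∈ Finset.range (l + 1), ∑ n ∈ Finset.range (i + 1),
    (l.choose m ^ 2 * i.choose n * (-1) ^ (i - n) * ((m + n)! * (l - m + (i - n))!) : ℝ) *
      a ^ (m + n) * b ^ (l - m + (i - n))

open scoped Nat in
-- Integrating out the phase of $C_{12}$ removes the cross terms of $|C_{12}\bar\delta-\bar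
-- C_{21}\delta|^{2l}$, with $\delta$ = `diagGap`. Each surviving term carries the same factor
-- $|\delta|^{2l}$, so the integral over $C_{11},C_{22}$ splits off and monomials in $|C_{12}|^2$
-- and $|C_{21}|^2$ remain.
theorem integral_blockGaussian_mul {a b : ℝ} (ha : 0 < a) (hb : 0 < b) (i l : ℕ) :
    ∫ c : BlockCoord, blockGaussian a b c * (offDiagGap c ^ i * ‖commEntry a b c‖ ^ (2 * l)) =
      Real.pi ^ 4 * a ^ 2 * b ^ 2 * blockMoment i l a b := by
  rw [Measure.volume_eq_prod, integral_prod _ (integrable_blockGaussian_mul ha hb i l)]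
  -- For fixed $C_{21}$, with $\eta=|C_{21}|^2$, the power of `offDiagGap` is radial in $C_{12}$ and
  -- can be counted as part of the weight.
  have hw : ∀ (η : ℝ) (n : ℕ), Integrable fun z : ℂ =>
      (Real.exp (-(‖z‖ ^ 2 / a)) * (‖z‖ ^ 2 - η) ^ i) * ‖z‖ ^ n := by
    intro η n
    have : ∀ z : ℂ, (Real.exp (-(‖z‖ ^ 2 / a)) * (‖z‖ ^ 2 - η) ^ i) * ‖z‖ ^ n =
        ∑ q ∈ Finset.range (i + 1), (i.choose q * (-η) ^ (i - q)) *
          (Real.exp (-(‖z‖ ^ 2 / a)) * ‖z‖ ^ (2 * q + n)) := by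
      intro z
      rw [sub_eq_add_neg, add_pow, Finset.mul_sum, Finset.sum_mul]
      refine Finset.sum_congr rfl fun q _ => ?_
      rw [pow_add, pow_mul]; ring
    simp only [this]
    exact integrable_finsetSum _ fun q _ => (integrable_gaussian_mul_norm_pow ha _).const_mul _
  have hw2 : ∀ (η : ℝ) (m : ℕ), ∫ z : ℂ,
      (Real.exp (-(‖z‖ ^ 2 / a)) * (‖z‖ ^ 2 - η) ^ i) * ‖z‖ ^ (2 * m) =
      ∑ q ∈ Finset.range (i + 1), (i.choose q * (-η) ^ (i - q)) *
        (Real.pi * (m + q)! * a ^ (m + q + 1)) := by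
    intro η m
    have : ∀ z : ℂ, (Real.exp (-(‖z‖ ^ 2 / a)) * (‖z‖ ^ 2 - η) ^ i) * ‖z‖ ^ (2 * m) =
        ∑ q ∈ Finset.range (i + 1), (i.choose q * (-η) ^ (i - q)) *
          (Real.exp (-(‖z‖ ^ 2 / a)) * ‖z‖ ^ (2 * (m + q))) := by
      intro z
      rw [sub_eq_add_neg, add_pow, Finset.mul_sum, Finset.sum_mul]
      refine Finset.sum_congr rfl fun q _ => ?_
      rw [mul_add, pow_add, pow_mul _ 2 q]; ring
    simp only [this]
    rw [integral_finsetSum _ fun q _ => (integrable_gaussian_mul_norm_pow ha _).const_mul _]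
    refine Finset.sum_congr rfl fun q _ => ?_
    rw [integral_const_mul, integral_gaussian_mul_norm_pow ha]
  have e : ∀ c : (ℂ × ℂ) × ℂ, ∫ z : ℂ, blockGaussian a b (c, z) *
      (offDiagGap (c, z) ^ i * ‖commEntry a b (c, z)‖ ^ (2 * l)) =
      (Real.exp (-(‖c.1.1‖ ^ 2 / a)) * Real.exp (-(‖c.1.2‖ ^ 2 / b)) *
        ‖diagGap a b c.1‖ ^ (2 * l)) *
      ∑ m ∈ Finset.range (l + 1), ∑ q ∈ Finset.range (i + 1),
        ((l.choose m : ℝ) ^ 2 * i.choose q * (-1) ^ (i - q) *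
          (Real.pi * (m + q)! * a ^ (m + q + 1))) *
          (Real.exp (-(‖c.2‖ ^ 2 / b)) * ‖c.2‖ ^ (2 * (l - m + (i - q)))) := by
    intro c
    have e1 : ∀ z : ℂ, blockGaussian a b (c, z) *
        (offDiagGap (c, z) ^ i * ‖commEntry a b (c, z)‖ ^ (2 * l)) =
        (Real.exp (-(‖c.1.1‖ ^ 2 / a)) * Real.exp (-(‖c.1.2‖ ^ 2 / b)) *
          Real.exp (-(‖c.2‖ ^ 2 / b))) *
        ((Real.exp (-(‖z‖ ^ 2 / a)) * (‖z‖ ^ 2 - ‖c.2‖ ^ 2) ^ i) *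
          ‖z * starRingEnd ℂ (diagGap a b c.1) - starRingEnd ℂ c.2 * diagGap a b c.1‖ ^ (2 * l)) :=
      fun z => by unfold blockGaussian offDiagGap commEntry; ring
    simp only [e1]
    rw [integral_const_mul, integral_radial_mul_norm_sub_pow
      (f := fun s => Real.exp (-(s ^ 2 / a)) * (s ^ 2 - ‖c.2‖ ^ 2) ^ i) (hw _), Finset.mul_sum,
      Finset.mul_sum]
    refine Finset.sum_congr rfl fun m hm => ?_
    have hm' : m ≤ l := Nat.lt_succ_iff.mp (Finset.mem_range.mp hm)
    rw [hw2, Finset.mul_sum, Finset.mul_sum, Finset.mul_sum]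
    refine Finset.sum_congr rfl fun q _ => ?_
    have e2 : ‖diagGap a b c.1‖ ^ (2 * l) =
        ‖diagGap a b c.1‖ ^ (2 * m) * ‖diagGap a b c.1‖ ^ (2 * (l - m)) := by
      rw [← pow_add]; congr 1; omega
    rw [norm_mul, RCLike.norm_conj, RCLike.norm_conj, e2, mul_pow, neg_pow (‖c.2‖ ^ 2), mul_add 2,
      pow_add ‖c.2‖, ← pow_mul ‖c.2‖ 2]
    ring
  simp only [e]
  have e3 := integral_prod_mul (μ := (volume : Measure (ℂ × ℂ))) (ν := (volume : Measure ℂ))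
    (fun c => Real.exp (-(‖c.1‖ ^ 2 / a)) * Real.exp (-(‖c.2‖ ^ 2 / b)) *
      ‖diagGap a b c‖ ^ (2 * l)) (fun z => ∑ m ∈ Finset.range (l + 1), ∑ q ∈ Finset.range (i + 1),
        ((l.choose m : ℝ) ^ 2 * i.choose q * (-1) ^ (i - q) *
          (Real.pi * (m + q)! * a ^ (m + q + 1))) *
          (Real.exp (-(‖z‖ ^ 2 / b)) * ‖z‖ ^ (2 * (l - m + (i - q)))))
  rw [Measure.volume_eq_prod, e3, integral_diagGap_pow ha hb, blockMoment,
    integral_finsetSum _ fun m _ => integrable_finsetSum _ fun q _ =>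
      (integrable_gaussian_mul_norm_pow hb _).const_mul _, Finset.mul_sum, Finset.mul_sum,
    Finset.mul_sum]
  refine Finset.sum_congr rfl fun m _ => ?_
  rw [integral_finsetSum _ fun q _ => (integrable_gaussian_mul_norm_pow hb _).const_mul _,
    Finset.mul_sum, Finset.mul_sum, Finset.mul_sum]
  refine Finset.sum_congr rfl fun q _ => ?_
  rw [integral_const_mul, integral_gaussian_mul_norm_pow hb]
  ring

/-! ### Averaging the Schur complement moments over the off-diagonal block -/

open scoped Nat in
/-- The normalized Gaussian mean of a moment of `hermWeight`. -/
noncomputable def blockSum (k j : ℕ) (a b : ℝ) : ℝ :=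
  ∑ m ∈ Finset.range (j + 1), if m % 2 = 0 then
    (j.choose m * m.choose (m / 2) : ℝ) * (((m / 2)! * k ! : ℝ) / (k + m / 2 + 1)!) *
    ∑ u ∈ Finset.range (j - m + 1), ∑ v ∈ Finset.range (j - m - u + 1),
      ∑ t ∈ Finset.range (j - m - u - v + 1),
      ((j - m).choose u * (j - m - u).choose v * (j - m - u - v).choose t *
        ((k + m / 2 + 1 + u)! * (k + m / 2 + 1 + v)!) : ℝ) *
        ((1 / a) ^ u * (-(1 / b)) ^ v * (-1) ^ (j - m - u - v) * (1 / (a * b)) ^ t) *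
        blockMoment (u + v + 2 * t) (j - m - u - v - t + m / 2) a b else 0

/-- The Wishart moment is a polynomial in $g$ and $|h|^2$, so it is averaged term by term. The index
$t$ counts the factors $g^2/(ab)$ chosen from powers of the constant term $-(g^2/(ab)+|h|^2)$. -/
theorem integral_blockGaussian_mul_hermSum {a b : ℝ} (ha : 0 < a) (hb : 0 < b) (k j : ℕ) :
    ∫ c : BlockCoord, blockGaussian a b c * hermSum k j (offDiagGap c / a) (-(offDiagGap c / b))
      (-(offDiagGap c ^ 2 / (a * b) + ‖commEntry a b c‖ ^ 2)) (‖commEntry a b c‖ ^ 2) =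
      Real.pi ^ 4 * a ^ 2 * b ^ 2 * blockSum k j a b := by
  have hI := integrable_blockGaussian_mul ha hb
  have e : ∀ (n i q : ℕ) (c : BlockCoord), blockGaussian a b c * ((‖commEntry a b c‖ ^ 2) ^ q *
      gammaSum n i (offDiagGap c / a) (-(offDiagGap c / b))
      (-(offDiagGap c ^ 2 / (a * b) + ‖commEntry a b c‖ ^ 2))) =
      ∑ u ∈ Finset.range (i + 1), ∑ v ∈ Finset.range (i - u + 1),
        ∑ t ∈ Finset.range (i - u - v + 1),
        ((i.choose u * (i - u).choose v * (i - u - v).choose t *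
          (((n + u).factorial : ℝ) * (n + v).factorial) : ℝ) *
          ((1 / a) ^ u * (-(1 / b)) ^ v * (-1) ^ (i - u - v) * (1 / (a * b)) ^ t)) *
          (blockGaussian a b c * (offDiagGap c ^ (u + v + 2 * t) *
            ‖commEntry a b c‖ ^ (2 * (i - u - v - t + q)))) := by
    intro n i q c
    rw [gammaSum, Finset.mul_sum, Finset.mul_sum]
    refine Finset.sum_congr rfl fun u _ => ?_
    rw [Finset.mul_sum, Finset.mul_sum]
    refine Finset.sum_congr rfl fun v _ => ?_
    rw [neg_pow (_ + _), add_pow, Finset.mul_sum, Finset.mul_sum, Finset.sum_mul, Finset.mul_sum,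
      Finset.mul_sum]
    refine Finset.sum_congr rfl fun t _ => ?_
    have h1 : offDiagGap c ^ (u + v + 2 * t) =
        offDiagGap c ^ u * offDiagGap c ^ v * (offDiagGap c ^ 2) ^ t := by
      rw [pow_add, pow_add, pow_mul]
    rw [div_eq_mul_one_div _ a, div_eq_mul_one_div _ b, div_eq_mul_one_div _ (a * b),
      ← mul_neg, mul_pow, mul_pow, mul_pow, pow_mul _ 2, h1, pow_add (‖commEntry a b c‖ ^ 2)]
    ring
  have e' : ∀ c : BlockCoord, blockGaussian a b c * hermSum k j (offDiagGap c / a)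
      (-(offDiagGap c / b)) (-(offDiagGap c ^ 2 / (a * b) + ‖commEntry a b c‖ ^ 2))
      (‖commEntry a b c‖ ^ 2) = ∑ m ∈ Finset.range (j + 1), if m % 2 = 0 then
        (j.choose m * m.choose (m / 2) : ℝ) *
        ((((m / 2).factorial * k.factorial : ℝ)) / (k + m / 2 + 1).factorial) *
        (blockGaussian a b c * ((‖commEntry a b c‖ ^ 2) ^ (m / 2) *
          gammaSum (k + m / 2 + 1) (j - m) (offDiagGap c / a) (-(offDiagGap c / b))
          (-(offDiagGap c ^ 2 / (a * b) + ‖commEntry a b c‖ ^ 2)))) else 0 := by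
    intro c
    rw [hermSum, Finset.mul_sum]
    refine Finset.sum_congr rfl fun m _ => ?_
    split_ifs
    · ring
    · simp
  simp only [e', e]
  rw [blockSum, Finset.mul_sum, integral_finsetSum]
  · refine Finset.sum_congr rfl fun m _ => ?_
    split_ifs
    · rw [integral_const_mul, integral_finsetSum _ fun u _ => integrable_finsetSum _ fun v _ =>
        integrable_finsetSum _ fun t _ => (hI _ _).const_mul _, mul_left_comm]
      congr 1
      rw [Finset.mul_sum]
      refine Finset.sum_congr rfl fun u _ => ?_
      rw [integral_finsetSum _ fun v _ => integrable_finsetSum _ fun t _ =>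
        (hI _ _).const_mul _, Finset.mul_sum]
      refine Finset.sum_congr rfl fun v _ => ?_
      rw [integral_finsetSum _ fun t _ => (hI _ _).const_mul _, Finset.mul_sum]
      refine Finset.sum_congr rfl fun t _ => ?_
      rw [integral_const_mul, integral_blockGaussian_mul ha hb]
      ring
    · simp
  · intro m _
    split_ifs
    · exact (integrable_finsetSum _ fun u _ => integrable_finsetSum _ fun v _ =>
        integrable_finsetSum _ fun t _ => (hI _ _).const_mul _).const_mul _
    · simp

open scoped Nat in
/-- The polynomial part of `blockMoment`. -/
def blockPoly (i l : ℕ) (a b : ℝ) : ℝ :=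
  ∑ m ∈ Finset.range (l + 1), ∑ n ∈ Finset.range (i + 1),
    (l.choose m ^ 2 * i.choose n * (-1) ^ (i - n) * ((m + n)! * (l - m + (i - n))!) : ℝ) *
      a ^ (m + n) * b ^ (l - m + (i - n))

open scoped Nat in
/-- The polynomial part of `blockSum`. -/
def blockPolySum (x j : ℕ) (a b : ℝ) : ℝ :=
  ∑ m ∈ Finset.range (j + 1), if m % 2 = 0 then
    (j.choose m * m.choose (m / 2) * (m / 2)! : ℝ) *
    ∑ u ∈ Finset.range (j - m + 1), ∑ v ∈ Finset.range (j - m - u + 1),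
      ∑ t ∈ Finset.range (j - m - u - v + 1),
      ((j - m).choose u * (j - m - u).choose v * (j - m - u - v).choose t *
        (-1) ^ (j - m - u) * (j - m - u - v - t + m / 2)! *
        ((x + m / 2).ascFactorial u * x.ascFactorial (m / 2 + v) : ℕ) : ℝ) *
        (a ^ (v + m / 2) * b ^ (u + m / 2) * (a + b) ^ (j - m - u - v - t + m / 2)) *
        blockPoly (u + v + 2 * t) (j - m - u - v - t + m / 2) a b else 0

open scoped Nat in
-- The factor $(ab)^j$ clears all inverse powers of $a$ and $b$. The Beta denominator $(k+m/2+1)!$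
-- cancels against one Gamma factorial, and after extracting $k!\,(k+1)!$ only rising factorials
-- remain; they are polynomial in $x=k+2$.
theorem mul_blockSum_eq {a b : ℝ} (ha : 0 < a) (hb : 0 < b) (k j : ℕ) :
    (a * b) ^ j * blockSum k j a b = k ! * (k + 1)! * blockPolySum (k + 2) j a b := by
  rw [blockSum, blockPolySum, Finset.mul_sum, Finset.mul_sum]
  refine Finset.sum_congr rfl fun m hm => ?_
  split_ifs with hm2
  · have hm' : m ≤ j := Nat.lt_succ_iff.mp (Finset.mem_range.mp hm)
    simp only [Finset.mul_sum]
    refine Finset.sum_congr rfl fun u hu => Finset.sum_congr rfl fun v hv =>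
      Finset.sum_congr rfl fun t ht => ?_
    rw [Finset.mem_range] at hu hv ht
    obtain ⟨c, rfl⟩ : ∃ c, m = 2 * c := ⟨m / 2, by omega⟩
    have hc : 2 * c / 2 = c := by omega
    rw [hc]
    -- With $d$ the number of remaining factors, every truncated subtraction in the exponents
    -- disappears.
    obtain ⟨d, rfl⟩ : ∃ d, j = 2 * c + u + v + t + d := ⟨j - (2 * c + u + v + t), by omega⟩
    have e1 : 2 * c + u + v + t + d - 2 * c - u - v = t + d := by omega
    have e2 : 2 * c + u + v + t + d - 2 * c - u = v + (t + d) := by omega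
    rw [e1, e2, add_tsub_cancel_left]
    have f1 : ((k + c + 1 + u)! : ℝ) = (k + c + 1)! * (k + 2 + c).ascFactorial u := by
      have := Nat.factorial_mul_ascFactorial (k + c + 1) u
      rw [show k + c + 1 + 1 = k + 2 + c by ring] at this
      exact_mod_cast this.symm
    have f2 : ((k + c + 1 + v)! : ℝ) = (k + 1)! * (k + 2).ascFactorial (c + v) := by
      have := Nat.factorial_mul_ascFactorial (k + 1) (c + v)
      rw [show k + 1 + (c + v) = k + c + 1 + v by ring] at this
      exact_mod_cast this.symm
    have f3 : (1 / a + 1 / b) ^ (d + c) = (a + b) ^ (d + c) *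
        ((1 / a) ^ (d + c) * (1 / b) ^ (d + c)) := by
      rw [← mul_pow, ← mul_pow]; congr 1; field_simp; ring
    have f4 : (a * b) ^ (2 * c + u + v + t + d) * ((1 / a) ^ u * (1 / b) ^ v * (1 / (a * b)) ^ t *
        ((1 / a) ^ (d + c) * (1 / b) ^ (d + c))) = a ^ (v + c) * b ^ (u + c) := by
      have h1 : (1 / a) * a = 1 := by field_simp
      have h2 : (1 / b) * b = 1 := by field_simp
      calc _ = ((1 / a) * a) ^ (u + t + d + c) * ((1 / b) * b) ^ (v + t + d + c) *
            (a ^ (v + c) * b ^ (u + c)) := by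
            rw [show 1 / (a * b) = 1 / a * (1 / b) by field_simp]; ring
        _ = _ := by rw [h1, h2]; simp
    rw [blockMoment, f3, ← f4, f1, f2, neg_pow (1 / b), blockPoly]
    have f5 : ((k + c + 1)! : ℝ) ≠ 0 := by positivity
    push_cast
    field_simp
    ring
  · simp

/-! ### Explicit polynomials for exponents up to four -/

section

variable (a b : ℝ)

/-- These expansions evaluate the index pairs met in `blockPolySum` up to $j=4$, apart from the
trivial $(0,0)$. -/
theorem blockPoly_0_1 : blockPoly 0 1 a b =
      a + b := by
  simp [blockPoly, Finset.sum_range_succ, Nat.factorial, Nat.choose]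
  ring

theorem blockPoly_0_2 : blockPoly 0 2 a b =
      2 * a ^ 2 + 4 * a * b + 2 * b ^ 2 := by
  simp [blockPoly, Finset.sum_range_succ, Nat.factorial, Nat.choose]
  ring

theorem blockPoly_0_3 : blockPoly 0 3 a b =
      6 * a ^ 3 + 18 * a ^ 2 * b + 18 * a * b ^ 2 + 6 * b ^ 3 := by
  simp [blockPoly, Finset.sum_range_succ, Nat.factorial, Nat.choose]
  ring

theorem blockPoly_0_4 : blockPoly 0 4 a b =
      24 * a ^ 4 + 96 * a ^ 3 * b + 144 * a ^ 2 * b ^ 2 + 96 * a * b ^ 3 + 24 * b ^ 4 := by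
  simp [blockPoly, Finset.sum_range_succ, Nat.factorial, Nat.choose]
  ring

theorem blockPoly_1_0 : blockPoly 1 0 a b =
      a - b := by
  simp [blockPoly, Finset.sum_range_succ, Nat.factorial, Nat.choose]
  ring

theorem blockPoly_1_1 : blockPoly 1 1 a b =
      2 * a ^ 2 - 2 * b ^ 2 := by
  simp [blockPoly, Finset.sum_range_succ, Nat.factorial, Nat.choose]
  ring

theorem blockPoly_1_2 : blockPoly 1 2 a b =
      6 * a ^ 3 + 6 * a ^ 2 * b - 6 * a * b ^ 2 - 6 * b ^ 3 := by
  simp [blockPoly, Finset.sum_range_succ, Nat.factorial, Nat.choose]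
  ring

theorem blockPoly_1_3 : blockPoly 1 3 a b =
      24 * a ^ 4 + 48 * a ^ 3 * b - 48 * a * b ^ 3 - 24 * b ^ 4 := by
  simp [blockPoly, Finset.sum_range_succ, Nat.factorial, Nat.choose]
  ring

theorem blockPoly_2_0 : blockPoly 2 0 a b =
      2 * a ^ 2 - 2 * a * b + 2 * b ^ 2 := by
  simp [blockPoly, Finset.sum_range_succ, Nat.factorial, Nat.choose]
  ring

theorem blockPoly_2_1 : blockPoly 2 1 a b =
      6 * a ^ 3 - 2 * a ^ 2 * b - 2 * a * b ^ 2 + 6 * b ^ 3 := by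
  simp [blockPoly, Finset.sum_range_succ, Nat.factorial, Nat.choose]
  ring

theorem blockPoly_2_2 : blockPoly 2 2 a b =
      24 * a ^ 4 + 12 * a ^ 3 * b - 24 * a ^ 2 * b ^ 2 + 12 * a * b ^ 3 + 24 * b ^ 4 := by
  simp [blockPoly, Finset.sum_range_succ, Nat.factorial, Nat.choose]
  ring

theorem blockPoly_2_3 : blockPoly 2 3 a b =
      120 * a ^ 5 + 168 * a ^ 4 * b - 96 * a ^ 3 * b ^ 2 - 96 * a ^ 2 * b ^ 3 + 168 * a * b ^
      4 + 120 * b ^ 5 := by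
  simp [blockPoly, Finset.sum_range_succ, Nat.factorial, Nat.choose]
  ring

theorem blockPoly_3_0 : blockPoly 3 0 a b =
      6 * a ^ 3 - 6 * a ^ 2 * b + 6 * a * b ^ 2 - 6 * b ^ 3 := by
  simp [blockPoly, Finset.sum_range_succ, Nat.factorial, Nat.choose]
  ring

theorem blockPoly_3_1 : blockPoly 3 1 a b =
      24 * a ^ 4 - 12 * a ^ 3 * b + 12 * a * b ^ 3 - 24 * b ^ 4 := by
  simp [blockPoly, Finset.sum_range_succ, Nat.factorial, Nat.choose]
  ring

theorem blockPoly_3_2 : blockPoly 3 2 a b =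
      120 * a ^ 5 + 24 * a ^ 4 * b - 96 * a ^ 3 * b ^ 2 + 96 * a ^ 2 * b ^ 3 - 24 * a * b ^ 4
      - 120 * b ^ 5 := by
  simp [blockPoly, Finset.sum_range_succ, Nat.factorial, Nat.choose]
  ring

theorem blockPoly_4_0 : blockPoly 4 0 a b =
      24 * a ^ 4 - 24 * a ^ 3 * b + 24 * a ^ 2 * b ^ 2 - 24 * a * b ^ 3 + 24 * b ^ 4 := by
  simp [blockPoly, Finset.sum_range_succ, Nat.factorial, Nat.choose]
  ring

theorem blockPoly_4_1 : blockPoly 4 1 a b =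
      120 * a ^ 5 - 72 * a ^ 4 * b + 24 * a ^ 3 * b ^ 2 + 24 * a ^ 2 * b ^ 3 - 72 * a * b ^ 4
      + 120 * b ^ 5 := by
  simp [blockPoly, Finset.sum_range_succ, Nat.factorial, Nat.choose]
  ring

theorem blockPoly_4_2 : blockPoly 4 2 a b =
      720 * a ^ 6 - 432 * a ^ 4 * b ^ 2 + 576 * a ^ 3 * b ^ 3 - 432 * a ^ 2 * b ^ 4 + 720 * b
      ^ 6 := by
  simp [blockPoly, Finset.sum_range_succ, Nat.factorial, Nat.choose]
  ring

theorem blockPoly_5_0 : blockPoly 5 0 a b =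
      120 * a ^ 5 - 120 * a ^ 4 * b + 120 * a ^ 3 * b ^ 2 - 120 * a ^ 2 * b ^ 3 + 120 * a * b
      ^ 4 - 120 * b ^ 5 := by
  simp [blockPoly, Finset.sum_range_succ, Nat.factorial, Nat.choose]
  ring

theorem blockPoly_5_1 : blockPoly 5 1 a b =
      720 * a ^ 6 - 480 * a ^ 5 * b + 240 * a ^ 4 * b ^ 2 - 240 * a ^ 2 * b ^ 4 + 480 * a * b
      ^ 5 - 720 * b ^ 6 := by
  simp [blockPoly, Finset.sum_range_succ, Nat.factorial, Nat.choose]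
  ring

theorem blockPoly_6_0 : blockPoly 6 0 a b =
      720 * a ^ 6 - 720 * a ^ 5 * b + 720 * a ^ 4 * b ^ 2 - 720 * a ^ 3 * b ^ 3 + 720 * a ^ 2
      * b ^ 4 - 720 * a * b ^ 5 + 720 * b ^ 6 := by
  simp [blockPoly, Finset.sum_range_succ, Nat.factorial, Nat.choose]
  ring

theorem blockPoly_6_1 : blockPoly 6 1 a b =
      5040 * a ^ 7 - 3600 * a ^ 6 * b + 2160 * a ^ 5 * b ^ 2 - 720 * a ^ 4 * b ^ 3 - 720 * a ^
      3 * b ^ 4 + 2160 * a ^ 2 * b ^ 5 - 3600 * a * b ^ 6 + 5040 * b ^ 7 := by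
  simp [blockPoly, Finset.sum_range_succ, Nat.factorial, Nat.choose]
  ring

theorem blockPoly_7_0 : blockPoly 7 0 a b =
      5040 * a ^ 7 - 5040 * a ^ 6 * b + 5040 * a ^ 5 * b ^ 2 - 5040 * a ^ 4 * b ^ 3 + 5040 * a
      ^ 3 * b ^ 4 - 5040 * a ^ 2 * b ^ 5 + 5040 * a * b ^ 6 - 5040 * b ^ 7 := by
  simp [blockPoly, Finset.sum_range_succ, Nat.factorial, Nat.choose]
  ring

theorem blockPoly_8_0 : blockPoly 8 0 a b =
      40320 * a ^ 8 - 40320 * a ^ 7 * b + 40320 * a ^ 6 * b ^ 2 - 40320 * a ^ 5 * b ^ 3 +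
      40320 * a ^ 4 * b ^ 4 - 40320 * a ^ 3 * b ^ 5 + 40320 * a ^ 2 * b ^ 6 - 40320 * a * b ^
      7 + 40320 * b ^ 8 := by
  simp [blockPoly, Finset.sum_range_succ, Nat.factorial, Nat.choose]
  ring

/-- The sum is homogeneous of degree $2j$ in $a,b$, and symmetric because swapping the two basis
vectors is a unitary conjugation. It is therefore a polynomial in $a+b$ and $ab$, the trace and
determinant of the upper block; this form lets the formula pass to non-diagonal blocks. -/
theorem blockPolySum_four (x : ℕ) : blockPolySum x 4 a b =
    (72576 + 39600 * x + 8040 * x ^ 2 + 720 * x ^ 3 + 24 * x ^ 4) * (a + b) ^ 8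
      - (580608 + 357120 * x + 81840 * x ^ 2 + 8280 * x ^ 3 + 312 * x ^ 4) * (a + b) ^ 6 * (a * b)
      + (1524096 + 1083600 * x + 287160 * x ^ 2 + 33600 * x ^ 3 + 1464 * x ^ 4) *
        (a + b) ^ 4 * (a * b) ^ 2
      - (1451520 + 1238400 * x + 393600 * x ^ 2 + 55200 * x ^ 3 + 2880 * x ^ 4) *
        (a + b) ^ 2 * (a * b) ^ 3
      + (362880 + 396000 * x + 160800 * x ^ 2 + 28800 * x ^ 3 + 1920 * x ^ 4) * (a * b) ^ 4 := by
  simp [blockPolySum, Finset.sum_range_succ, Nat.factorial, Nat.choose, Nat.ascFactorial,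
    blockPoly_0_4, blockPoly_1_3, blockPoly_2_2, blockPoly_2_3, blockPoly_3_2, blockPoly_4_0,
    blockPoly_4_1, blockPoly_4_2, blockPoly_5_1, blockPoly_6_0, blockPoly_6_1, blockPoly_8_0,
    blockPoly_7_0, blockPoly_5_0, blockPoly_0_2, blockPoly_0_3, blockPoly_1_2, blockPoly_2_1,
    blockPoly_3_1]
  ring

theorem blockPolySum_zero (x : ℕ) : blockPolySum x 0 a b = 1 := by
  simp [blockPolySum, blockPoly]

theorem blockPolySum_one (x : ℕ) : blockPolySum x 1 a b =
    -(3 + x) * (a + b) ^ 2 + (6 + 4 * x) * (a * b) := by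
  simp [blockPolySum, Finset.sum_range_succ, Nat.ascFactorial, blockPoly_0_1, blockPoly_1_0,
    blockPoly_2_0]
  ring

theorem blockPolySum_two (x : ℕ) : blockPolySum x 2 a b =
    (40 + 18 * x + 2 * x ^ 2) * (a + b) ^ 4 - (160 + 96 * x + 14 * x ^ 2) * (a + b) ^ 2 * (a * b)
      + (120 + 108 * x + 24 * x ^ 2) * (a * b) ^ 2 := by
  simp [blockPolySum, Finset.sum_range_succ, Nat.choose, Nat.ascFactorial,
    blockPoly_0_1, blockPoly_0_2, blockPoly_1_1, blockPoly_2_0, blockPoly_2_1, blockPoly_3_0,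
    blockPoly_4_0]
  ring

theorem blockPolySum_three (x : ℕ) : blockPolySum x 3 a b =
    -(1260 + 642 * x + 108 * x ^ 2 + 6 * x ^ 3) * (a + b) ^ 6
      + (7560 + 4572 * x + 912 * x ^ 2 + 60 * x ^ 3) * (a + b) ^ 4 * (a * b)
      - (12600 + 9480 * x + 2352 * x ^ 2 + 192 * x ^ 3) * (a + b) ^ 2 * (a * b) ^ 2
      + (5040 + 5136 * x + 1728 * x ^ 2 + 192 * x ^ 3) * (a * b) ^ 3 := by
  simp [blockPolySum, Finset.sum_range_succ, Nat.factorial, Nat.choose, Nat.ascFactorial,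
    blockPoly_0_2, blockPoly_0_3, blockPoly_1_1, blockPoly_1_2, blockPoly_2_1, blockPoly_2_2,
    blockPoly_3_0, blockPoly_3_1, blockPoly_4_0, blockPoly_4_1, blockPoly_5_0, blockPoly_6_0]
  ring

end

/-! ### Block matrices and Hermitian coordinates -/

/-- The matrix of a two-qubit basis label as block index and index within the block. -/
def twoQubitEquiv : TwoQubit ≃ Fin 2 ⊕ Fin 2 where
  toFun i := if i.1 = 0 then Sum.inl i.2 else Sum.inr i.2
  invFun := Sum.elim (fun b => (0, b)) (fun b => (1, b))
  left_inv := by decide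
  right_inv := by decide

/-- The `4 × 4` matrix with diagonal blocks `A`, `B` and upper off-diagonal block `C`, lower
off-diagonal block `Cᴴ`. -/
def blockMatrix (A C B : Matrix (Fin 2) (Fin 2) ℂ) : Matrix TwoQubit TwoQubit ℂ :=
  (fromBlocks A C Cᴴ B).submatrix twoQubitEquiv twoQubitEquiv

theorem partialTranspose_blockMatrix (A C B : Matrix (Fin 2) (Fin 2) ℂ) :
    partialTranspose (blockMatrix A C B) = blockMatrix Aᵀ Cᵀ Bᵀ := by
  ext ⟨i, i'⟩ ⟨j, j'⟩
  fin_cases i <;> fin_cases j <;> simp [partialTranspose, blockMatrix, twoQubitEquiv]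

theorem det_blockMatrix {A : Matrix (Fin 2) (Fin 2) ℂ} (hA : IsUnit A.det)
    (C B : Matrix (Fin 2) (Fin 2) ℂ) :
    (blockMatrix A C B).det = A.det * (B - Cᴴ * A⁻¹ * C).det := by
  let _ := A.invertibleOfIsUnitDet hA
  rw [blockMatrix, det_submatrix_equiv_self, det_fromBlocks₁₁, invOf_eq_nonsing_inv]

theorem posSemidef_blockMatrix_iff {A : Matrix (Fin 2) (Fin 2) ℂ} (hA : A.PosDef)
    (C B : Matrix (Fin 2) (Fin 2) ℂ) :
    (blockMatrix A C B).PosSemidef ↔ (B - Cᴴ * A⁻¹ * C).PosSemidef := by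
  let _ := A.invertibleOfIsUnitDet ((Matrix.isUnit_iff_isUnit_det A).mp hA.isUnit)
  rw [blockMatrix, posSemidef_submatrix_equiv, hA.fromBlocks₁₁]

theorem PosSemidef.upper_block {A C B : Matrix (Fin 2) (Fin 2) ℂ}
    (h : (blockMatrix A C B).PosSemidef) : A.PosSemidef := by
  have := h.submatrix fun i : Fin 2 => ((0, i) : TwoQubit)
  convert this using 1
  ext i j
  simp [blockMatrix, twoQubitEquiv]

/-- The block diagonal matrix with blocks $U,U$ is $1\otimes U$: acting on the second qubit
conjugates all blocks simultaneously. -/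
theorem blockMatrix_conj (U A C B : Matrix (Fin 2) (Fin 2) ℂ) :
    blockMatrix (U * A * Uᴴ) (U * C * Uᴴ) (U * B * Uᴴ) =
      (fromBlocks U 0 0 U).submatrix twoQubitEquiv twoQubitEquiv * blockMatrix A C B *
        ((fromBlocks U 0 0 U).submatrix twoQubitEquiv twoQubitEquiv)ᴴ := by
  rw [blockMatrix, blockMatrix, conjTranspose_submatrix, submatrix_mul_equiv, submatrix_mul_equiv,
    fromBlocks_conjTranspose, fromBlocks_multiply, fromBlocks_multiply]
  simp [conjTranspose_mul, Matrix.mul_assoc]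

theorem det_blockMatrix_conj {U : Matrix (Fin 2) (Fin 2) ℂ} (hU : U * Uᴴ = 1)
    (A C B : Matrix (Fin 2) (Fin 2) ℂ) :
    (blockMatrix (U * A * Uᴴ) (U * C * Uᴴ) (U * B * Uᴴ)).det = (blockMatrix A C B).det := by
  rw [blockMatrix_conj, det_mul, det_mul, mul_right_comm, ← det_mul, conjTranspose_submatrix,
    submatrix_mul_equiv, fromBlocks_conjTranspose, fromBlocks_multiply]
  simp [hU]

theorem trace_blockMatrix (A C B : Matrix (Fin 2) (Fin 2) ℂ) :
    (blockMatrix A C B).trace = A.trace + B.trace := by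
  simp [Matrix.trace, Fintype.sum_prod_type, blockMatrix, twoQubitEquiv]

/-- The Hermitian `2 × 2` matrix with given coordinates. -/
def hermMatrix (p : HermCoord) : Matrix (Fin 2) (Fin 2) ℂ :=
  !![(p.1.1 : ℂ), p.2; starRingEnd ℂ p.2, (p.1.2 : ℂ)]

/-- The coordinates of a Hermitian `2 × 2` matrix. -/
def hermCoord (M : Matrix (Fin 2) (Fin 2) ℂ) : HermCoord := (((M 0 0).re, (M 1 1).re), M 0 1)

/-- The `2 × 2` matrix with given coordinates. -/
def genMatrix (c : BlockCoord) : Matrix (Fin 2) (Fin 2) ℂ := !![c.1.1.1, c.2; c.1.2, c.1.1.2]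

/-- The coordinates of a `2 × 2` matrix. -/
def genCoord (M : Matrix (Fin 2) (Fin 2) ℂ) : BlockCoord := (((M 0 0, M 1 1), M 1 0), M 0 1)

theorem isHermitian_hermMatrix (p : HermCoord) : (hermMatrix p).IsHermitian := by
  ext i j; fin_cases i <;> fin_cases j <;> simp [hermMatrix]

theorem hermMatrix_hermCoord {M : Matrix (Fin 2) (Fin 2) ℂ} (h : M.IsHermitian) :
    hermMatrix (hermCoord M) = M := by
  have h00 := Complex.conj_eq_iff_re.mp (h.apply 0 0)
  have h11 := Complex.conj_eq_iff_re.mp (h.apply 1 1)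
  have h10 := h.apply 1 0
  ext i j; fin_cases i <;> fin_cases j <;> simp_all [hermMatrix, hermCoord]

theorem genMatrix_genCoord (M : Matrix (Fin 2) (Fin 2) ℂ) : genMatrix (genCoord M) = M := by
  ext i j; fin_cases i <;> fin_cases j <;> simp [genMatrix, genCoord]

theorem hermCoord_hermMatrix (p : HermCoord) : hermCoord (hermMatrix p) = p := by
  simp [hermMatrix, hermCoord]

theorem genCoord_genMatrix (c : BlockCoord) : genCoord (genMatrix c) = c := by
  simp [genMatrix, genCoord]

theorem det_hermMatrix (p : HermCoord) :
    (hermMatrix p).det = ((p.1.1 * p.1.2 - ‖p.2‖ ^ 2 : ℝ) : ℂ) := by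
  rw [hermMatrix, det_fin_two_of, Complex.mul_conj']; push_cast; rfl

theorem trace_hermMatrix (p : HermCoord) :
    (hermMatrix p).trace = ((p.1.1 + p.1.2 : ℝ) : ℂ) := by
  simp [hermMatrix, Matrix.trace]

/-- For the converse, $|p_{12}|\le\sqrt{p_{11}p_{22}}$ bounds the quadratic form below by
$(\sqrt{p_{11}}|x_0|-\sqrt{p_{22}}|x_1|)^2$. -/
theorem posSemidef_hermMatrix_iff (p : HermCoord) :
    (hermMatrix p).PosSemidef ↔ p ∈ hermCone := by
  constructor
  · intro h
    have h0 := h.diag_nonneg (i := 0)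
    have h1 := h.diag_nonneg (i := 1)
    have h2 := h.det_nonneg
    rw [det_hermMatrix] at h2
    simp only [hermMatrix, of_apply, cons_val', cons_val_zero, cons_val_one,
      cons_val_fin_one] at h0 h1
    exact ⟨by exact_mod_cast h0, by exact_mod_cast h1, by linarith [Complex.zero_le_real.mp h2]⟩
  · rintro ⟨ha, hb, hz⟩
    refine .of_dotProduct_mulVec_nonneg (isHermitian_hermMatrix p) fun x => ?_
    have e : star x ⬝ᵥ hermMatrix p *ᵥ x = ((p.1.1 * ‖x 0‖ ^ 2 + p.1.2 * ‖x 1‖ ^ 2 +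
        2 * (starRingEnd ℂ (x 0) * p.2 * x 1).re : ℝ) : ℂ) := by
      have h1 : ((2 * (starRingEnd ℂ (x 0) * p.2 * x 1).re : ℝ) : ℂ) =
          starRingEnd ℂ (x 0) * p.2 * x 1 + x 0 * starRingEnd ℂ p.2 * starRingEnd ℂ (x 1) := by
        rw [← Complex.add_conj]; simp
      rw [Complex.ofReal_add, h1]
      push_cast
      rw [← Complex.mul_conj', ← Complex.mul_conj']
      simp [hermMatrix, dotProduct, mulVec, Fin.sum_univ_two]
      ring
    rw [e, Complex.zero_le_real]
    have h2 : |(starRingEnd ℂ (x 0) * p.2 * x 1).re| ≤ ‖x 0‖ * ‖p.2‖ * ‖x 1‖ := by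
      refine (Complex.abs_re_le_norm _).trans ?_
      rw [norm_mul, norm_mul, RCLike.norm_conj]
    have h3 : ‖p.2‖ ≤ √p.1.1 * √p.1.2 := by
      rw [← Real.sqrt_mul ha]; exact Real.le_sqrt_of_sq_le hz
    have h4 : ‖x 0‖ * ‖p.2‖ * ‖x 1‖ ≤ ‖x 0‖ * (√p.1.1 * √p.1.2) * ‖x 1‖ := by gcongr
    have h5 := sq_nonneg (√p.1.1 * ‖x 0‖ - √p.1.2 * ‖x 1‖)
    have h6 := Real.sq_sqrt ha
    have h7 := Real.sq_sqrt hb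
    have h8 := neg_abs_le (starRingEnd ℂ (x 0) * p.2 * x 1).re
    calc (0 : ℝ) ≤ (√p.1.1 * ‖x 0‖ - √p.1.2 * ‖x 1‖) ^ 2 := h5
      _ = √p.1.1 ^ 2 * ‖x 0‖ ^ 2 + √p.1.2 ^ 2 * ‖x 1‖ ^ 2 -
          2 * (‖x 0‖ * (√p.1.1 * √p.1.2) * ‖x 1‖) := by ring
      _ ≤ _ := by rw [h6, h7]; linarith

/-! ### The weighted determinant products on the 4 × 4 cone -/

/-- Real coordinates of `4 × 4` Hermitian matrices: the upper diagonal block, and the upper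
off-diagonal and lower diagonal blocks. -/
abbrev StateCoord : Type := HermCoord × (BlockCoord × HermCoord)

/-- The Hermitian `4 × 4` matrix with given coordinates. -/
def stateMatrix (w : StateCoord) : Matrix TwoQubit TwoQubit ℂ :=
  blockMatrix (hermMatrix w.1) (genMatrix w.2.1) (hermMatrix w.2.2)

theorem trace_stateMatrix (w : StateCoord) :
    (stateMatrix w).trace = ((w.1.1.1 + w.1.1.2 + (w.2.2.1.1 + w.2.2.1.2) : ℝ) : ℂ) := by
  rw [stateMatrix, trace_blockMatrix, trace_hermMatrix, trace_hermMatrix]; push_cast; rfl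

theorem isHermitian_stateMatrix (w : StateCoord) : (stateMatrix w).IsHermitian := by
  refine IsHermitian.submatrix ?_ _
  exact IsHermitian.fromBlocks (isHermitian_hermMatrix _) rfl (isHermitian_hermMatrix _)

theorem continuous_stateMatrix : Continuous stateMatrix := by
  refine continuous_pi fun i => continuous_pi fun j => ?_
  obtain ⟨i, i'⟩ := i
  obtain ⟨j, j'⟩ := j
  fin_cases i <;> fin_cases j <;> fin_cases i' <;> fin_cases j' <;>
    simp [stateMatrix, blockMatrix, twoQubitEquiv, hermMatrix, genMatrix] <;> fun_prop

theorem continuous_partialTranspose : Continuous partialTranspose :=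
  continuous_pi fun _ => continuous_pi fun _ => continuous_apply_apply _ _

theorem isClosed_setOf_posSemidef : IsClosed {M : Matrix TwoQubit TwoQubit ℂ | M.PosSemidef} := by
  simp only [posSemidef_iff_dotProduct_mulVec, Set.ofPred_and, Set.ofPred_forall]
  refine IsClosed.inter (isClosed_eq (by fun_prop) continuous_id) (isClosed_iInter fun x => ?_)
  exact isClosed_le continuous_const (by fun_prop)

/-- The entries of a positive semidefinite matrix are bounded by its trace. -/
theorem PosSemidef.norm_apply_le_trace {n : Type*} [Fintype n] {M : Matrix n n ℂ}
    (h : M.PosSemidef) (i j : n) : ‖M i j‖ ≤ M.trace.re := by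
  have hd : ∀ i, 0 ≤ (M i i).re := fun i => (Complex.nonneg_iff.mp h.diag_nonneg).1
  have him : ∀ i, M i i = ((M i i).re : ℂ) := fun i =>
    (Complex.conj_eq_iff_re.mp (h.1.apply i i)).symm
  have hle : ∀ i, (M i i).re ≤ M.trace.re := by
    intro i
    rw [Matrix.trace, Complex.re_sum]
    exact Finset.single_le_sum (f := fun i => (M i i).re) (fun i _ => hd i) (Finset.mem_univ i)
  -- Nonnegativity of the 2 × 2 minor gives $|M_{ij}|^2\le M_{ii}M_{jj}$; the case $i=j$ is
  -- harmless.
  have h1 := (h.submatrix ![i, j]).det_nonneg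
  rw [det_fin_two] at h1
  simp only [submatrix_apply, cons_val_zero, cons_val_one] at h1
  rw [← h.1.apply j i, Complex.star_def, Complex.mul_conj', him i, him j] at h1
  have h2 : 0 ≤ (M i i).re * (M j j).re - ‖M i j‖ ^ 2 := by exact_mod_cast h1
  have h3 : ‖M i j‖ ^ 2 ≤ M.trace.re ^ 2 := by
    have := mul_le_mul (hle i) (hle j) (hd j) ((hd i).trans (hle i))
    linarith
  exact abs_le_of_sq_le_sq' h3 ((hd i).trans (hle i)) |>.2

theorem norm_le_trace_of_posSemidef {w : StateCoord} (h : (stateMatrix w).PosSemidef) :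
    ‖w‖ ≤ (stateMatrix w).trace.re := by
  have hb := PosSemidef.norm_apply_le_trace h
  have e : w.1.1.1 = (stateMatrix w (0, 0) (0, 0)).re := by
    simp [stateMatrix, blockMatrix, twoQubitEquiv, hermMatrix]
  have e2 : w.1.1.2 = (stateMatrix w (0, 1) (0, 1)).re := by
    simp [stateMatrix, blockMatrix, twoQubitEquiv, hermMatrix]
  have e3 : w.1.2 = stateMatrix w (0, 0) (0, 1) := by
    simp [stateMatrix, blockMatrix, twoQubitEquiv, hermMatrix]
  have e4 : w.2.2.1.1 = (stateMatrix w (1, 0) (1, 0)).re := by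
    simp [stateMatrix, blockMatrix, twoQubitEquiv, hermMatrix]
  have e5 : w.2.2.1.2 = (stateMatrix w (1, 1) (1, 1)).re := by
    simp [stateMatrix, blockMatrix, twoQubitEquiv, hermMatrix]
  have e6 : w.2.2.2 = stateMatrix w (1, 0) (1, 1) := by
    simp [stateMatrix, blockMatrix, twoQubitEquiv, hermMatrix]
  have e7 : w.2.1.1.1.1 = stateMatrix w (0, 0) (1, 0) := by
    simp [stateMatrix, blockMatrix, twoQubitEquiv, genMatrix]
  have e8 : w.2.1.1.1.2 = stateMatrix w (0, 1) (1, 1) := by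
    simp [stateMatrix, blockMatrix, twoQubitEquiv, genMatrix]
  have e9 : w.2.1.1.2 = stateMatrix w (0, 1) (1, 0) := by
    simp [stateMatrix, blockMatrix, twoQubitEquiv, genMatrix]
  have e10 : w.2.1.2 = stateMatrix w (0, 0) (1, 1) := by
    simp [stateMatrix, blockMatrix, twoQubitEquiv, genMatrix]
  have hr : ∀ i j, |(stateMatrix w i j).re| ≤ (stateMatrix w).trace.re := fun i j =>
    (Complex.abs_re_le_norm _).trans (hb i j)
  refine max_le (max_le (max_le ?_ ?_) ?_) (max_le (max_le (max_le (max_le ?_ ?_) ?_) ?_)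
    (max_le (max_le ?_ ?_) ?_))
  · exact e ▸ hr _ _
  · exact e2 ▸ hr _ _
  · exact e3 ▸ hb _ _
  · exact e7 ▸ hb _ _
  · exact e8 ▸ hb _ _
  · exact e9 ▸ hb _ _
  · exact e10 ▸ hb _ _
  · exact e4 ▸ hr _ _
  · exact e5 ▸ hr _ _
  · exact e6 ▸ hb _ _

/-- The Leibniz expansion has $4!=24$ terms, each a product of four entries. -/
theorem norm_det_le_of_forall_norm_le {M : Matrix TwoQubit TwoQubit ℂ} {t : ℝ}
    (h : ∀ i j, ‖M i j‖ ≤ t) : ‖M.det‖ ≤ 24 * t ^ 4 := by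
  have := det_le (abv := NormedField.toAbsoluteValue ℂ) (A := M) (x := t) h
  have h4 : (Fintype.card TwoQubit).factorial = 24 := rfl
  rw [h4, nsmul_eq_mul] at this
  exact_mod_cast this

instance : (volume : Measure (BlockCoord × HermCoord)).IsAddHaarMeasure :=
  isAddHaarMeasure_volume_prod

instance : (volume : Measure StateCoord).IsAddHaarMeasure := isAddHaarMeasure_volume_prod

open Classical in
/-- The function `|W| ^ k (|W^PT| - |W|) ^ j exp (-tr W)` on the cone of positive semidefinite
matrices. -/
noncomputable def wishartIntegrand (k j : ℕ) (w : StateCoord) : ℝ :=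
  if (stateMatrix w).PosSemidef then (stateMatrix w).det.re ^ k *
    ((partialTranspose (stateMatrix w)).det.re - (stateMatrix w).det.re) ^ j *
    Real.exp (-(stateMatrix w).trace.re) else 0

theorem measurable_wishartIntegrand (k j : ℕ) : Measurable (wishartIntegrand k j) := by
  have h := continuous_stateMatrix
  have h2 := continuous_partialTranspose.comp h
  refine Measurable.ite (isClosed_setOf_posSemidef.preimage h).measurableSet
    (Continuous.measurable ?_) measurable_const
  have h3 : Continuous fun w => (stateMatrix w).det.re := Complex.continuous_re.comp h.matrix_det
  have h4 : Continuous fun w => (partialTranspose (stateMatrix w)).det.re :=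
    Complex.continuous_re.comp h2.matrix_det
  have h5 : Continuous fun w => (stateMatrix w).trace.re :=
    Complex.continuous_re.comp h.matrix_trace
  fun_prop

/-- All entries are bounded by the trace, and partial transposition only rearranges them, so both
determinants obey the same quartic bound; $48$ bounds their difference. -/
theorem wishartIntegrand_bound (k j : ℕ) (w : StateCoord) :
    wishartIntegrand k j w = 0 ∨ ∃ t : ℝ, ‖w‖ ≤ t ∧
      |wishartIntegrand k j w| ≤ 24 ^ k * 48 ^ j * (1 + t) ^ (4 * k + 4 * j) * Real.exp (-t) := by
  by_cases h : (stateMatrix w).PosSemidef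
  · refine Or.inr ⟨(stateMatrix w).trace.re, norm_le_trace_of_posSemidef h, ?_⟩
    rw [wishartIntegrand, if_pos h]
    set t := (stateMatrix w).trace.re with ht
    have ht0 : 0 ≤ t := (norm_nonneg w).trans (norm_le_trace_of_posSemidef h)
    have h4 : t ^ 4 ≤ (1 + t) ^ 4 := by gcongr; linarith
    have h1 : |(stateMatrix w).det.re| ≤ 24 * (1 + t) ^ 4 := by
      have := (Complex.abs_re_le_norm _).trans
        (norm_det_le_of_forall_norm_le (PosSemidef.norm_apply_le_trace h))
      linarith
    have h2 : |(partialTranspose (stateMatrix w)).det.re| ≤ 24 * (1 + t) ^ 4 := by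
      have := (Complex.abs_re_le_norm _).trans (norm_det_le_of_forall_norm_le
        (M := partialTranspose (stateMatrix w)) (t := t)
        fun i j => PosSemidef.norm_apply_le_trace h _ _)
      linarith
    have h3 : |(partialTranspose (stateMatrix w)).det.re - (stateMatrix w).det.re| ≤
        48 * (1 + t) ^ 4 := by
      have := abs_sub (partialTranspose (stateMatrix w)).det.re (stateMatrix w).det.re
      linarith
    rw [abs_mul, abs_mul, abs_pow, abs_pow, abs_of_pos (Real.exp_pos _)]
    calc _ ≤ (24 * (1 + t) ^ 4) ^ k * (48 * (1 + t) ^ 4) ^ j * Real.exp (-t) := by gcongr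
      _ = _ := by rw [mul_pow, mul_pow, pow_add, pow_mul, pow_mul]; ring
  · left; rw [wishartIntegrand, if_neg h]

theorem integrable_wishartIntegrand (k j : ℕ) : Integrable (wishartIntegrand k j) :=
  integrable_of_exp_decay (measurable_wishartIntegrand k j).aestronglyMeasurable _ _
    (wishartIntegrand_bound k j)

/-- Fubini would give this only for almost every $p$, whereas the slices at diagonal $p$, a null
set, are the ones evaluated explicitly. -/
theorem integrable_wishartIntegrand_slice (k j : ℕ) (p : HermCoord) :
    Integrable fun q => wishartIntegrand k j (p, q) := by
  refine integrable_of_exp_decay ((measurable_wishartIntegrand k j).comp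
    measurable_prodMk_left).aestronglyMeasurable (24 ^ k * 48 ^ j) (4 * k + 4 * j) fun q => ?_
  rcases wishartIntegrand_bound k j (p, q) with h | ⟨t, h1, h2⟩
  · exact Or.inl h
  · exact Or.inr ⟨t, (norm_snd_le (p, q)).trans h1, h2⟩

/-! ### Slices with diagonal upper block -/

/-- The integral of `wishartIntegrand` over the matrices with a given upper diagonal block. -/
noncomputable def sliceIntegral (k j : ℕ) (p : HermCoord) : ℝ :=
  ∫ q : BlockCoord × HermCoord, wishartIntegrand k j (p, q)

/-- The coordinates of `Cᴴ D⁻¹ C`, for `D = diag(a, b)`. -/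
noncomputable def schurShift (a b : ℝ) (c : BlockCoord) : HermCoord :=
  ((‖c.1.1.1‖ ^ 2 / a + ‖c.1.2‖ ^ 2 / b, ‖c.2‖ ^ 2 / a + ‖c.1.1.2‖ ^ 2 / b),
    starRingEnd ℂ c.1.1.1 * c.2 / a + starRingEnd ℂ c.1.2 * c.1.1.2 / b)

theorem inv_hermMatrix_diagonal {a b : ℝ} (ha : 0 < a) (hb : 0 < b) :
    (hermMatrix ((a, b), 0))⁻¹ = !![(1 / a : ℂ), 0; 0, (1 / b : ℂ)] := by
  have ha' : (a : ℂ) ≠ 0 := by exact_mod_cast ha.ne'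
  have hb' : (b : ℂ) ≠ 0 := by exact_mod_cast hb.ne'
  refine Matrix.inv_eq_right_inv ?_
  ext i j; fin_cases i <;> fin_cases j <;> simp [hermMatrix, ha', hb']

theorem schur_diagonal {a b : ℝ} (ha : 0 < a) (hb : 0 < b) (c : BlockCoord) (s : HermCoord) :
    hermMatrix (s + schurShift a b c) -
      (genMatrix c)ᴴ * (hermMatrix ((a, b), 0))⁻¹ * genMatrix c = hermMatrix s := by
  rw [inv_hermMatrix_diagonal ha hb]
  ext i j; fin_cases i <;> fin_cases j <;>
    simp [hermMatrix, genMatrix, schurShift, Matrix.mul_apply, Fin.sum_univ_two,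
      ← Complex.mul_conj'] <;> ring

theorem det_stateMatrix_diagonal {a b : ℝ} (ha : 0 < a) (hb : 0 < b) (c : BlockCoord)
    (s : HermCoord) : (stateMatrix (((a, b), 0), (c, s + schurShift a b c))).det.re =
      a * b * (s.1.1 * s.1.2 - ‖s.2‖ ^ 2) := by
  have hd : (hermMatrix ((a, b), 0)).det = ((a * b : ℝ) : ℂ) := by rw [det_hermMatrix]; simp
  have hu : IsUnit (hermMatrix ((a, b), 0)).det := by
    rw [hd, isUnit_iff_ne_zero]; exact_mod_cast (mul_pos ha hb).ne'
  rw [stateMatrix, det_blockMatrix hu, schur_diagonal ha hb, hd, det_hermMatrix,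
    ← Complex.ofReal_mul, Complex.ofReal_re]

/-- The Schur complement of the partial transpose is the transpose of $S+N$, with
$N=C^*D^{-1}C-CD^{-1}C^*$. Thus the difference is $ab(|S+N|-|S|)$, in which the terms quadratic in
$S$ cancel: the cross terms are linear in $S$ and the constant is $|N|=-g^2/(ab)-|h|^2$. -/
theorem det_partialTranspose_stateMatrix_diagonal {a b : ℝ} (ha : 0 < a) (hb : 0 < b)
    (c : BlockCoord) (s : HermCoord) :
    (partialTranspose (stateMatrix (((a, b), 0), (c, s + schurShift a b c)))).det.re -
      (stateMatrix (((a, b), 0), (c, s + schurShift a b c))).det.re =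
      a * b * (offDiagGap c / a * s.1.1 + -(offDiagGap c / b) * s.1.2 +
        -(offDiagGap c ^ 2 / (a * b) + ‖commEntry a b c‖ ^ 2) +
        2 * (s.2 * starRingEnd ℂ (-commEntry a b c)).re) := by
  have hd : (hermMatrix ((a, b), 0)).det = ((a * b : ℝ) : ℂ) := by rw [det_hermMatrix]; simp
  have hu : IsUnit (hermMatrix ((a, b), 0)).det := by
    rw [hd, isUnit_iff_ne_zero]; exact_mod_cast (mul_pos ha hb).ne'
  have ht : (hermMatrix ((a, b), 0))ᵀ = hermMatrix ((a, b), 0) := by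
    ext i j; fin_cases i <;> fin_cases j <;> simp [hermMatrix]
  rw [det_stateMatrix_diagonal ha hb, stateMatrix, partialTranspose_blockMatrix, ht,
    det_blockMatrix hu, hd, inv_hermMatrix_diagonal ha hb]
  have ha' : (a : ℂ) ≠ 0 := by exact_mod_cast ha.ne'
  have hb' : (b : ℂ) ≠ 0 := by exact_mod_cast hb.ne'
  rw [Complex.re_ofReal_mul, ← mul_sub]
  congr 1
  rw [← Complex.ofReal_inj]
  have hr : ∀ z : ℂ, z.im = 0 → ((z.re : ℝ) : ℂ) = z := fun z hz =>
      Complex.ext (by simp) (by simp [hz])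
  have h2 : ((2 * (s.2 * starRingEnd ℂ (-commEntry a b c)).re : ℝ) : ℂ) =
      s.2 * starRingEnd ℂ (-commEntry a b c) + starRingEnd ℂ s.2 * (-commEntry a b c) := by
    rw [← Complex.add_conj]; simp
  rw [Complex.ofReal_sub, Complex.ofReal_add _ (2 * _), h2, hr]
  · push_cast
    simp only [offDiagGap, commEntry, diagGap, Complex.ofReal_sub, Complex.ofReal_pow,
      ← Complex.mul_conj', det_fin_two, hermMatrix, genMatrix, schurShift]
    simp [Matrix.mul_apply, Fin.sum_univ_two, ← Complex.mul_conj']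
    field_simp
    ring
  -- This Schur complement is Hermitian, so its determinant is real and taking the real part loses
  -- nothing.
  · have hM : ((hermMatrix (s + schurShift a b c))ᵀ -
        (genMatrix c)ᵀᴴ * !![(1 / a : ℂ), 0; 0, (1 / b : ℂ)] * (genMatrix c)ᵀ).IsHermitian := by
      refine IsHermitian.sub (isHermitian_hermMatrix _).transpose ?_
      rw [← inv_hermMatrix_diagonal ha hb]
      exact isHermitian_conjTranspose_mul_mul _ (isHermitian_hermMatrix _).inv
    rw [← hermMatrix_hermCoord hM, det_hermMatrix, Complex.ofReal_im]

/-- Since $D>0$, positivity of $W$ is positivity of $S$, and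
$\operatorname{tr}W=a+b+\operatorname{tr}S+\operatorname{tr}C^*D^{-1}C$ splits the exponential. -/
theorem wishartIntegrand_diagonal {a b : ℝ} (ha : 0 < a) (hb : 0 < b) (k j : ℕ) (c : BlockCoord)
    (s : HermCoord) : wishartIntegrand k j (((a, b), 0), (c, s + schurShift a b c)) =
      (Real.exp (-(a + b)) * (a * b) ^ (k + j) * blockGaussian a b c) * (hermWeight k s *
        (offDiagGap c / a * s.1.1 + -(offDiagGap c / b) * s.1.2 +
        -(offDiagGap c ^ 2 / (a * b) + ‖commEntry a b c‖ ^ 2) +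
        2 * (s.2 * starRingEnd ℂ (-commEntry a b c)).re) ^ j) := by
  have hD : (hermMatrix ((a, b), 0)).PosDef := by
    have e : hermMatrix ((a, b), 0) = diagonal ![(a : ℂ), (b : ℂ)] := by
      ext i j; fin_cases i <;> fin_cases j <;> simp [hermMatrix]
    rw [e]
    refine PosDef.diagonal fun i => ?_
    fin_cases i
    · exact Complex.zero_lt_real.mpr ha
    · exact Complex.zero_lt_real.mpr hb
  have hiff : (stateMatrix (((a, b), 0), (c, s + schurShift a b c))).PosSemidef ↔ s ∈ hermCone := by
    rw [stateMatrix, posSemidef_blockMatrix_iff hD, schur_diagonal ha hb, posSemidef_hermMatrix_iff]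
  by_cases hs : s ∈ hermCone
  · rw [wishartIntegrand, if_pos (hiff.mpr hs), hermWeight, if_pos hs,
      det_partialTranspose_stateMatrix_diagonal ha hb, det_stateMatrix_diagonal ha hb,
      trace_stateMatrix, Complex.ofReal_re, mul_pow (a * b), mul_pow (a * b)]
    have e : Real.exp (-(a + b + ((s + schurShift a b c).1.1 + (s + schurShift a b c).1.2))) =
        Real.exp (-(a + b)) * blockGaussian a b c * Real.exp (-(s.1.1 + s.1.2)) := by
      rw [blockGaussian, ← Real.exp_add, ← Real.exp_add, ← Real.exp_add, ← Real.exp_add,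
        ← Real.exp_add]
      congr 1
      simp only [schurShift, Prod.fst_add, Prod.snd_add]
      ring
    simp only at e ⊢
    rw [e]; ring
  · rw [wishartIntegrand, if_neg fun h => hs (hiff.mp h), hermWeight, if_neg hs]; simp

open scoped Nat in
theorem sliceIntegral_diagonal {a b : ℝ} (ha : 0 < a) (hb : 0 < b) (k j : ℕ) :
    sliceIntegral k j ((a, b), 0) = Real.pi ^ 5 * (k ! * (k + 1)!) *
      (Real.exp (-(a + b)) * (a * b) ^ (k + 2) * blockPolySum (k + 2) j a b) := by
  have h := integrable_wishartIntegrand_slice k j ((a, b), 0)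
  rw [sliceIntegral, Measure.volume_eq_prod, integral_prod _ h]
  have e : ∀ c : BlockCoord, ∫ s : HermCoord, wishartIntegrand k j (((a, b), 0), (c, s)) =
      (Real.exp (-(a + b)) * (a * b) ^ (k + j) * Real.pi) * (blockGaussian a b c *
        hermSum k j (offDiagGap c / a) (-(offDiagGap c / b))
        (-(offDiagGap c ^ 2 / (a * b) + ‖commEntry a b c‖ ^ 2)) (‖commEntry a b c‖ ^ 2)) := by
    intro c
    -- Translation invariance allows $S$ to replace $B$ as the variable for fixed $C$.
    rw [← integral_add_right_eq_self _ (schurShift a b c)]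
    simp only [wishartIntegrand_diagonal ha hb]
    rw [integral_const_mul, integral_hermWeight_mul, norm_neg]; ring
  simp only [e]
  rw [integral_const_mul, integral_blockGaussian_mul_hermSum ha hb]
  have h2 := mul_blockSum_eq ha hb k j
  linear_combination (Real.exp (-(a + b)) * (a * b) ^ (k + 2) * Real.pi ^ 5) * h2

/-! ### Unitary invariance and diagonalization of the upper block -/

/-- A linear automorphism preserving a continuous function with a bounded sublevel set
neighbourhood of `0` preserves Haar measure. -/
theorem measurePreserving_of_invariant {E : Type*} [NormedAddCommGroup E] [NormedSpace ℝ E]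
    [FiniteDimensional ℝ E] [MeasurableSpace E] [BorelSpace E] (μ : Measure E)
    [μ.IsAddHaarMeasure] (T : E ≃ₗ[ℝ] E) {q : E → ℝ} (hq : Continuous q) (h0 : q 0 < 1)
    (hb : Bornology.IsBounded {x | q x < 1}) (hT : ∀ x, q (T x) = q x) :
    MeasurePreserving T μ μ := by
  have hdet : LinearMap.det (T : E →ₗ[ℝ] E) ≠ 0 := T.isUnit_det'.ne_zero
  have hopen : IsOpen {x | q x < 1} := isOpen_lt hq continuous_const
  have h1 := Measure.addHaar_preimage_linearMap μ hdet {x | q x < 1}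
  have h2 : ⇑(T : E →ₗ[ℝ] E) ⁻¹' {x | q x < 1} = {x | q x < 1} := by
    ext x
    simp only [Set.mem_preimage, Set.mem_ofPred_eq, LinearEquiv.coe_coe, hT]
  rw [h2] at h1
  -- The sublevel set is its own preimage and has positive finite measure, so the factor $|\det
  -- T|^{-1}$ must be 1.
  have h3 : μ {x | q x < 1} ≠ 0 := (hopen.measure_pos μ ⟨0, h0⟩).ne'
  have h4 : μ {x | q x < 1} ≠ ⊤ := hb.measure_lt_top.ne
  have h5 : ENNReal.ofReal |(LinearMap.det (T : E →ₗ[ℝ] E))⁻¹| = 1 :=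
    ((ENNReal.mul_eq_right h3 h4).mp h1.symm)
  refine ⟨(LinearMap.continuous_of_finiteDimensional (T : E →ₗ[ℝ] E)).measurable, ?_⟩
  have h6 := Measure.map_linearMap_addHaar_eq_smul_addHaar μ hdet
  rw [h5, one_smul] at h6
  exact h6

/-- Conjugation by `U` on the pairs of an off-diagonal and a lower diagonal block. -/
def conjLinear (U : Matrix (Fin 2) (Fin 2) ℂ) :
    (BlockCoord × HermCoord) →ₗ[ℝ] (BlockCoord × HermCoord) where
  toFun q := (genCoord (U * genMatrix q.1 * Uᴴ), hermCoord (U * hermMatrix q.2 * Uᴴ))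
  map_add' p q := by
    have h1 : genMatrix (p + q).1 = genMatrix p.1 + genMatrix q.1 := by
      ext i j; fin_cases i <;> fin_cases j <;> simp [genMatrix]
    have h2 : hermMatrix (p + q).2 = hermMatrix p.2 + hermMatrix q.2 := by
      ext i j; fin_cases i <;> fin_cases j <;> simp [hermMatrix]
    rw [h1, h2, Matrix.mul_add, Matrix.mul_add, Matrix.add_mul, Matrix.add_mul]
    simp [genCoord, hermCoord]
  map_smul' r q := by
    have h1 : genMatrix (r • q).1 = r • genMatrix q.1 := by
      ext i j; fin_cases i <;> fin_cases j <;> simp [genMatrix]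
    have h2 : hermMatrix (r • q).2 = r • hermMatrix q.2 := by
      ext i j; fin_cases i <;> fin_cases j <;> simp [hermMatrix]
    rw [h1, h2, Matrix.mul_smul, Matrix.mul_smul, Matrix.smul_mul, Matrix.smul_mul]
    simp [genCoord, hermCoord]

theorem genMatrix_conjLinear (U : Matrix (Fin 2) (Fin 2) ℂ) (q : BlockCoord × HermCoord) :
    genMatrix (conjLinear U q).1 = U * genMatrix q.1 * Uᴴ := genMatrix_genCoord _

theorem hermMatrix_conjLinear (U : Matrix (Fin 2) (Fin 2) ℂ) (q : BlockCoord × HermCoord) :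
    hermMatrix (conjLinear U q).2 = U * hermMatrix q.2 * Uᴴ :=
  hermMatrix_hermCoord (isHermitian_mul_mul_conjTranspose U (isHermitian_hermMatrix q.2))

theorem conjLinear_conjTranspose {U : Matrix (Fin 2) (Fin 2) ℂ} (hU : U * Uᴴ = 1)
    (q : BlockCoord × HermCoord) : conjLinear U (conjLinear Uᴴ q) = q := by
  have h : ∀ M : Matrix (Fin 2) (Fin 2) ℂ, U * (Uᴴ * M * Uᴴᴴ) * Uᴴ = M := by
    intro M
    rw [conjTranspose_conjTranspose, Matrix.mul_assoc, Matrix.mul_assoc, Matrix.mul_assoc, hU,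
      Matrix.mul_one, ← Matrix.mul_assoc, hU, Matrix.one_mul]
  refine Prod.ext ?_ ?_
  · rw [← genCoord_genMatrix (conjLinear U _).1, genMatrix_conjLinear, genMatrix_conjLinear, h,
      genCoord_genMatrix]
  · rw [← hermCoord_hermMatrix (conjLinear U _).2, hermMatrix_conjLinear, hermMatrix_conjLinear, h,
      hermCoord_hermMatrix]

/-- Conjugation by a unitary matrix, as a linear automorphism. -/
noncomputable def conjLinearEquiv {U : Matrix (Fin 2) (Fin 2) ℂ} (hU : U * Uᴴ = 1) :
    (BlockCoord × HermCoord) ≃ₗ[ℝ] (BlockCoord × HermCoord) :=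
  LinearEquiv.ofLinearMap (conjLinear U) (conjLinear Uᴴ)
    (LinearMap.ext fun q => conjLinear_conjTranspose hU q)
    (LinearMap.ext fun q => by
      have := conjLinear_conjTranspose (U := Uᴴ)
        (by rw [conjTranspose_conjTranspose]; exact mul_eq_one_comm.mp hU) q
      rwa [conjTranspose_conjTranspose] at this)

/-- The invariant function is $\operatorname{tr}C^*C+\operatorname{tr}B^*B$, whose unit sublevel set
lies in the unit ball of the coordinates. -/
theorem measurePreserving_conjLinearEquiv {U : Matrix (Fin 2) (Fin 2) ℂ} (hU : U * Uᴴ = 1) :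
    MeasurePreserving (conjLinearEquiv hU) volume volume := by
  have htr : ∀ M : Matrix (Fin 2) (Fin 2) ℂ,
      ((U * M * Uᴴ)ᴴ * (U * M * Uᴴ)).trace.re = (Mᴴ * M).trace.re := by
    intro M
    have e : (U * M * Uᴴ)ᴴ * (U * M * Uᴴ) = U * (Mᴴ * M) * Uᴴ := by
      have hU' := mul_eq_one_comm.mp hU
      simp only [conjTranspose_mul, conjTranspose_conjTranspose, Matrix.mul_assoc]
      rw [← Matrix.mul_assoc Uᴴ U, hU', Matrix.one_mul]
    rw [e, trace_mul_cycle, mul_eq_one_comm.mp hU, Matrix.one_mul]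
  have hfrob : ∀ M : Matrix (Fin 2) (Fin 2) ℂ, (Mᴴ * M).trace.re =
      ‖M 0 0‖ ^ 2 + ‖M 1 0‖ ^ 2 + (‖M 0 1‖ ^ 2 + ‖M 1 1‖ ^ 2) := by
    intro M
    simp only [← Complex.normSq_eq_norm_sq, Complex.normSq_apply]
    simp [Matrix.trace, Matrix.mul_apply, Fin.sum_univ_two]
  have hpow : ∀ {x y : ℝ}, x ^ 2 ≤ y → y < 1 → x ≤ 1 := fun h1 h2 => by nlinarith
  refine measurePreserving_of_invariant volume (conjLinearEquiv hU)
    (q := fun p => ((genMatrix p.1)ᴴ * genMatrix p.1).trace.re +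
      ((hermMatrix p.2)ᴴ * hermMatrix p.2).trace.re) ?_ ?_ ?_ ?_
  · simp only [hfrob]
    simp only [genMatrix, hermMatrix, of_apply, cons_val', cons_val_zero, cons_val_one,
      cons_val_fin_one]
    fun_prop
  · simp [hfrob, genMatrix, hermMatrix]
  · refine (Metric.isBounded_closedBall (x := 0) (r := 1)).subset fun p hp => ?_
    rw [mem_closedBall_zero_iff]
    simp only [Set.mem_ofPred_eq, hfrob] at hp
    simp only [genMatrix, hermMatrix, of_apply, cons_val', cons_val_zero, cons_val_one,
      cons_val_fin_one, Complex.norm_real, RCLike.norm_conj] at hp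
    have h1 := sq_nonneg ‖p.1.1.1.1‖
    have h2 := sq_nonneg ‖p.1.1.1.2‖
    have h3 := sq_nonneg ‖p.1.1.2‖
    have h4 := sq_nonneg ‖p.1.2‖
    have h5 := sq_nonneg ‖p.2.1.1‖
    have h6 := sq_nonneg ‖p.2.1.2‖
    have h7 := sq_nonneg ‖p.2.2‖
    refine max_le (max_le (max_le (max_le ?_ ?_) ?_) ?_) (max_le (max_le ?_ ?_) ?_) <;>
      exact hpow (by linarith) hp
  · intro p
    change ((genMatrix (conjLinear U p).1)ᴴ * genMatrix (conjLinear U p).1).trace.re +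
      ((hermMatrix (conjLinear U p).2)ᴴ * hermMatrix (conjLinear U p).2).trace.re = _
    rw [genMatrix_conjLinear, hermMatrix_conjLinear, htr, htr]

theorem wishartIntegrand_conj {U : Matrix (Fin 2) (Fin 2) ℂ} (hU : U * Uᴴ = 1) (k j : ℕ)
    {p p' : HermCoord} (hp : hermMatrix p' = U * hermMatrix p * Uᴴ) (q : BlockCoord × HermCoord) :
    wishartIntegrand k j (p', conjLinear U q) = wishartIntegrand k j (p, q) := by
  have hM : stateMatrix (p', conjLinear U q) = blockMatrix (U * hermMatrix p * Uᴴ)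
      (U * genMatrix q.1 * Uᴴ) (U * hermMatrix q.2 * Uᴴ) := by
    rw [stateMatrix, hp, genMatrix_conjLinear, hermMatrix_conjLinear]
  -- On the partially transposed blocks the conjugation is by $\bar U$, again unitary, so that
  -- determinant is invariant too.
  have hT : ∀ M : Matrix (Fin 2) (Fin 2) ℂ, (U * M * Uᴴ)ᵀ = Uᴴᵀ * Mᵀ * Uᴴᵀᴴ := by
    intro M
    rw [transpose_mul, transpose_mul, Matrix.mul_assoc]
    congr 2
    ext i j; simp
  have hU' : Uᴴᵀ * Uᴴᵀᴴ = 1 := by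
    have : Uᴴᵀᴴ = Uᵀ := by ext i j; simp
    rw [this, ← transpose_mul, hU, transpose_one]
  have hdet : (stateMatrix (p', conjLinear U q)).det = (stateMatrix (p, q)).det := by
    rw [hM, det_blockMatrix_conj hU]; rfl
  have hdetPT : (partialTranspose (stateMatrix (p', conjLinear U q))).det =
      (partialTranspose (stateMatrix (p, q))).det := by
    rw [hM, partialTranspose_blockMatrix, hT, hT, hT, det_blockMatrix_conj hU', stateMatrix,
      partialTranspose_blockMatrix]
  have htr : (stateMatrix (p', conjLinear U q)).trace = (stateMatrix (p, q)).trace := by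
    have hU'' := mul_eq_one_comm.mp hU
    rw [hM, trace_blockMatrix, trace_mul_cycle, trace_mul_cycle U (hermMatrix q.2), hU'',
      Matrix.one_mul, Matrix.one_mul, stateMatrix, trace_blockMatrix]
  have hpsd : (stateMatrix (p', conjLinear U q)).PosSemidef ↔ (stateMatrix (p, q)).PosSemidef := by
    rw [hM, blockMatrix_conj]
    refine IsUnit.posSemidef_star_right_conjugate_iff (IsUnit.of_mul_eq_one
      (((fromBlocks U 0 0 U).submatrix twoQubitEquiv twoQubitEquiv)ᴴ) ?_)
    rw [conjTranspose_submatrix, submatrix_mul_equiv, fromBlocks_conjTranspose, fromBlocks_multiply]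
    simp [hU]
  by_cases h : (stateMatrix (p, q)).PosSemidef
  · rw [wishartIntegrand, wishartIntegrand, if_pos (hpsd.mpr h), if_pos h, hdet, hdetPT, htr]
  · rw [wishartIntegrand, wishartIntegrand, if_neg (mt hpsd.mp h), if_neg h]

theorem sliceIntegral_conj {U : Matrix (Fin 2) (Fin 2) ℂ} (hU : U * Uᴴ = 1) (k j : ℕ)
    {p p' : HermCoord} (hp : hermMatrix p' = U * hermMatrix p * Uᴴ) :
    sliceIntegral k j p' = sliceIntegral k j p := by
  have h := (measurePreserving_conjLinearEquiv hU).integral_comp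
    (conjLinearEquiv hU).toContinuousLinearEquiv.toHomeomorph.measurableEmbedding
    (fun q => wishartIntegrand k j (p', q))
  rw [sliceIntegral, ← h, sliceIntegral]
  exact integral_congr_ae (Filter.Eventually.of_forall fun q => wishartIntegrand_conj hU k j hp q)

/-- Unitary diagonalization in the interior of `hermCone`. -/
theorem exists_diagonalization {p : HermCoord} (hp : p ∈ hermCone)
    (hd : p.1.1 * p.1.2 - ‖p.2‖ ^ 2 ≠ 0) : ∃ (U : Matrix (Fin 2) (Fin 2) ℂ) (a b : ℝ),
      U * Uᴴ = 1 ∧ 0 < a ∧ 0 < b ∧ a + b = p.1.1 + p.1.2 ∧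
      a * b = p.1.1 * p.1.2 - ‖p.2‖ ^ 2 ∧ hermMatrix p = U * hermMatrix ((a, b), 0) * Uᴴ := by
  have hpsd := (posSemidef_hermMatrix_iff p).mpr hp
  set U : Matrix (Fin 2) (Fin 2) ℂ := (hpsd.1.eigenvectorUnitary :
    Matrix (Fin 2) (Fin 2) ℂ) with hUdef
  set a := hpsd.1.eigenvalues 0 with ha
  set b := hpsd.1.eigenvalues 1 with hb
  have hU : U * Uᴴ = 1 := Unitary.mul_star_self_of_mem hpsd.1.eigenvectorUnitary.2
  have hspec : hermMatrix p = U * hermMatrix ((a, b), 0) * Uᴴ := by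
    have h := hpsd.1.spectral_theorem
    rw [Unitary.conjStarAlgAut_apply] at h
    have e : diagonal (RCLike.ofReal ∘ hpsd.1.eigenvalues) = hermMatrix ((a, b), 0) := by
      ext i j; fin_cases i <;> fin_cases j <;> simp [hermMatrix, ha, hb]
    rwa [e] at h
  have htr : p.1.1 + p.1.2 = a + b := by
    have h := congrArg Matrix.trace hspec
    rw [trace_mul_cycle, mul_eq_one_comm.mp hU, Matrix.one_mul, trace_hermMatrix,
      trace_hermMatrix] at h
    exact_mod_cast h
  have hdet : p.1.1 * p.1.2 - ‖p.2‖ ^ 2 = a * b := by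
    have h := congrArg Matrix.det hspec
    rw [det_mul, det_mul, mul_right_comm, ← det_mul, hU, det_one, one_mul, det_hermMatrix,
      det_hermMatrix] at h
    simpa using Complex.ofReal_inj.mp h
  have h0 : 0 ≤ a := hpsd.eigenvalues_nonneg 0
  have h1 : 0 ≤ b := hpsd.eigenvalues_nonneg 1
  rw [hdet] at hd
  exact ⟨U, a, b, hU, h0.lt_of_ne (left_ne_zero_of_mul hd).symm,
    h1.lt_of_ne (right_ne_zero_of_mul hd).symm, htr.symm, hdet.symm, hspec⟩

/-- For fixed diagonal, the off-diagonal entries of singular matrices lie on a circle, which has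
measure zero in the plane. -/
theorem ae_det_ne_zero : ∀ᵐ p : HermCoord, p.1.1 * p.1.2 - ‖p.2‖ ^ 2 ≠ 0 := by
  have hm : MeasurableSet {p : HermCoord | p.1.1 * p.1.2 - ‖p.2‖ ^ 2 = 0} :=
    measurableSet_eq_fun (by fun_prop) (by fun_prop)
  have h := (Measure.measure_prod_null (μ := (volume : Measure (ℝ × ℝ)))
    (ν := (volume : Measure ℂ)) hm).mpr (Filter.Eventually.of_forall fun q => ?_)
  · rw [ae_iff]
    simp only [ne_eq, not_not]
    exact h
  · refine measure_mono_null (fun z hz => ?_) (Measure.addHaar_sphere volume (0 : ℂ) (√(q.1 * q.2)))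
    have hz' : q.1 * q.2 - ‖z‖ ^ 2 = 0 := hz
    rw [mem_sphere_zero_iff_norm, sub_eq_zero.mp hz',
      Real.sqrt_sq (norm_nonneg z)]

/-! ### Integration over the upper block and the Wishart moments -/

open scoped Nat in
-- Invertible positive blocks are diagonalized, and a function of $a+b$ and $ab$ does not depend on
-- the diagonalizing unitary. Outside the cone the slice vanishes, since diagonal blocks of a
-- positive matrix are positive.
theorem sliceIntegral_ae_eq (k j : ℕ) {G : ℝ → ℝ → ℝ}
    (hG : ∀ a b, blockPolySum (k + 2) j a b = G (a + b) (a * b)) :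
    ∀ᵐ p : HermCoord, sliceIntegral k j p = Real.pi ^ 5 * (k ! * (k + 1)!) *
      (hermWeight (k + 2) p * G (p.1.1 + p.1.2) (p.1.1 * p.1.2 - ‖p.2‖ ^ 2)) := by
  filter_upwards [ae_det_ne_zero] with p hp
  by_cases h : p ∈ hermCone
  · obtain ⟨U, a, b, hU, ha, hb, h1, h2, h3⟩ := exists_diagonalization h hp
    rw [sliceIntegral_conj hU k j h3, sliceIntegral_diagonal ha hb, hermWeight, if_pos h, hG, h1,
      h2]
    ring
  · have h0 : ∀ q, wishartIntegrand k j (p, q) = 0 := fun q => by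
      rw [wishartIntegrand, if_neg]
      exact fun hq => h ((posSemidef_hermMatrix_iff p).mp (PosSemidef.upper_block hq))
    rw [sliceIntegral, hermWeight, if_neg h]
    simp [h0]

open scoped Nat in
-- With $h=r=0$ only the terms $m=0$, $u+v=l$ survive, and Vandermonde's identity for rising
-- factorials sums them. The listed exponents are the values of $2(j-i)$ for $j\le 4$.
theorem hermSum_trace_pow (n : ℕ) {l : ℕ} (hl : l ∈ ({0, 2, 4, 6, 8} : Finset ℕ)) :
    hermSum n l 1 1 0 0 = n ! * (n + 1)! * (2 * n + 4).ascFactorial l := by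
  have h0 : hermSum n l 1 1 0 0 = (n ! : ℝ) / (n + 1)! * gammaSum (n + 1) l 1 1 0 := by
    rw [hermSum, Finset.sum_eq_single 0]
    · simp
    · intro m _ hm
      split_ifs with h
      · rw [zero_pow (by omega)]; simp
      · rfl
    · simp
  have h1 : gammaSum (n + 1) l 1 1 0 =
      (n + 1)! ^ 2 * ∑ u ∈ Finset.range (l + 1), (l.choose u : ℝ) *
        ((n + 2).ascFactorial u * (n + 2).ascFactorial (l - u)) := by
    rw [gammaSum, Finset.mul_sum]
    refine Finset.sum_congr rfl fun u _ => ?_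
    rw [Finset.sum_eq_single (l - u)]
    · rw [← Nat.factorial_mul_ascFactorial (n + 1) u,
        ← Nat.factorial_mul_ascFactorial (n + 1) (l - u)]
      push_cast
      simp
      ring
    · intro v hv hne
      rw [Finset.mem_range] at hv
      rw [zero_pow (by omega)]; simp
    · simp
  rw [h0, h1]
  have h2 : (∑ u ∈ Finset.range (l + 1), (l.choose u : ℝ) *
      ((n + 2).ascFactorial u * (n + 2).ascFactorial (l - u))) = (2 * n + 4).ascFactorial l := by
    fin_cases hl
    all_goals
      simp [Finset.sum_range_succ, Nat.choose, Nat.ascFactorial]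
      try ring
  rw [h2]
  have : ((n + 1)! : ℝ) ≠ 0 := by positivity
  field_simp

open scoped Nat in
/-- The moments of `|W^PT| - |W|` in terms of the coefficients of `blockPolySum`. -/
theorem integral_wishartIntegrand (k : ℕ) {j : ℕ} (hj : j ≤ 4) {co : ℕ → ℝ}
    (hco : ∀ a b, blockPolySum (k + 2) j a b =
      ∑ i ∈ Finset.range (j + 1), co i * ((a + b) ^ (2 * (j - i)) * (a * b) ^ i)) :
    ∫ w, wishartIntegrand k j w = Real.pi ^ 6 * (k ! * (k + 1)!) *
      ∑ i ∈ Finset.range (j + 1), co i * ((k + 2 + i)! * (k + 3 + i)! *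
        (2 * (k + 2 + i) + 4).ascFactorial (2 * (j - i))) := by
  rw [Measure.volume_eq_prod, integral_prod _ (integrable_wishartIntegrand k j)]
  change ∫ p, sliceIntegral k j p = _
  rw [integral_congr_ae (sliceIntegral_ae_eq k j
    (G := fun s d => ∑ i ∈ Finset.range (j + 1), co i * (s ^ (2 * (j - i)) * d ^ i)) hco)]
  -- Powers of the determinant raise the index of the weight; powers of the trace are powers of the
  -- linear form with $x=y=1$.
  have e : ∀ p : HermCoord, hermWeight (k + 2) p * ∑ i ∈ Finset.range (j + 1), co i *
      ((p.1.1 + p.1.2) ^ (2 * (j - i)) * (p.1.1 * p.1.2 - ‖p.2‖ ^ 2) ^ i) =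
      ∑ i ∈ Finset.range (j + 1), co i * (hermWeight (k + 2 + i) p *
        (1 * p.1.1 + 1 * p.1.2 + 0 + 2 * (p.2 * starRingEnd ℂ 0).re) ^ (2 * (j - i))) := by
    intro p
    rw [Finset.mul_sum]
    refine Finset.sum_congr rfl fun i _ => ?_
    unfold hermWeight
    split_ifs
    · simp [pow_add]; ring
    · simp
  simp only [e]
  rw [integral_const_mul, integral_finsetSum _ fun i _ =>
    (integrable_hermWeight_mul _ _ _ _ _ _).const_mul _, Finset.mul_sum, Finset.mul_sum]
  refine Finset.sum_congr rfl fun i hi => ?_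
  rw [integral_const_mul, integral_hermWeight_mul, norm_zero, zero_pow two_ne_zero,
    hermSum_trace_pow, show k + 3 + i = k + 2 + i + 1 by ring]
  · ring
  · have : j - i ≤ 4 := by omega
    interval_cases j - i <;> simp

open scoped Nat in
theorem integral_wishartIntegrand_zero (k : ℕ) : ∫ w, wishartIntegrand k 0 w =
    Real.pi ^ 6 * (k ! * (k + 1)! * (k + 2)! * (k + 3)!) := by
  rw [integral_wishartIntegrand k (j := 0) (by norm_num) (co := fun _ => 1)
    (by simp [blockPolySum_zero])]
  simp
  ring

theorem integral_wishartIntegrand_succ_zero (k : ℕ) : ∫ w, wishartIntegrand (k + 1) 0 w =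
    (k + 1) * (k + 2) * (k + 3) * (k + 4) * ∫ w, wishartIntegrand k 0 w := by
  rw [integral_wishartIntegrand_zero, integral_wishartIntegrand_zero]
  simp only [show k + 1 + 1 = k + 2 by ring, show k + 1 + 2 = k + 3 by ring,
    show k + 1 + 3 = k + 4 by ring, Nat.factorial_succ]
  push_cast
  ring

/-- Here and for higher $j$, `co` lists the coefficients of the corresponding `blockPolySum` at
$x=k+2$. -/
theorem integral_wishartIntegrand_one (k : ℕ) : ∫ w, wishartIntegrand k 1 w =
    -12 * (k + 4) ^ 2 * ∫ w, wishartIntegrand k 0 w := by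
  rw [integral_wishartIntegrand_zero, integral_wishartIntegrand k (j := 1) (by norm_num)
    (co := fun i => if i = 0 then -(3 + (k + 2 : ℕ)) else 6 + 4 * (k + 2 : ℕ))
    (by intro a b; rw [blockPolySum_one]; simp [Finset.sum_range_succ])]
  simp [Finset.sum_range_succ, Nat.ascFactorial, Nat.factorial_succ]
  ring

theorem integral_wishartIntegrand_two (k : ℕ) : ∫ w, wishartIntegrand k 2 w =
    24 * (k + 4) * (12 + 41 * (k + 4) + 47 * (k + 4) ^ 2 + 19 * (k + 4) ^ 3 + (k + 4) ^ 4) *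
      ∫ w, wishartIntegrand k 0 w := by
  rw [integral_wishartIntegrand_zero, integral_wishartIntegrand k (j := 2) (by norm_num)
    (co := fun i => if i = 0 then 40 + 18 * (k + 2 : ℕ) + 2 * (k + 2 : ℕ) ^ 2 else if i = 1 then
      -(160 + 96 * (k + 2 : ℕ) + 14 * (k + 2 : ℕ) ^ 2) else
      120 + 108 * (k + 2 : ℕ) + 24 * (k + 2 : ℕ) ^ 2)
    (by intro a b; rw [blockPolySum_two]; simp [Finset.sum_range_succ]; ring)]
  simp [Finset.sum_range_succ, Nat.ascFactorial, Nat.factorial_succ]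
  ring

theorem integral_wishartIntegrand_three (k : ℕ) : ∫ w, wishartIntegrand k 3 w =
    -1440 * (k + 4) * (192 + 644 * (k + 4) + 860 * (k + 4) ^ 2 + 581 * (k + 4) ^ 3 +
      206 * (k + 4) ^ 4 + 35 * (k + 4) ^ 5 + 2 * (k + 4) ^ 6) * ∫ w, wishartIntegrand k 0 w := by
  rw [integral_wishartIntegrand_zero, integral_wishartIntegrand k (j := 3) (by norm_num)
    (co := fun i =>
      if i = 0 then -(1260 + 642 * (k + 2 : ℕ) + 108 * (k + 2 : ℕ) ^ 2 + 6 * (k + 2 : ℕ) ^ 3)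
      else if i = 1 then
        7560 + 4572 * (k + 2 : ℕ) + 912 * (k + 2 : ℕ) ^ 2 + 60 * (k + 2 : ℕ) ^ 3
      else if i = 2 then
        -(12600 + 9480 * (k + 2 : ℕ) + 2352 * (k + 2 : ℕ) ^ 2 + 192 * (k + 2 : ℕ) ^ 3)
      else 5040 + 5136 * (k + 2 : ℕ) + 1728 * (k + 2 : ℕ) ^ 2 + 192 * (k + 2 : ℕ) ^ 3)
    (by intro a b; rw [blockPolySum_three]; simp [Finset.sum_range_succ]; ring)]
  simp [Finset.sum_range_succ, Nat.ascFactorial, Nat.factorial_succ]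
  ring

theorem integral_wishartIntegrand_four (k : ℕ) : ∫ w, wishartIntegrand k 4 w =
    2880 * (k + 4) * (302400 + 1063260 * (k + 4) + 1569780 * (k + 4) ^ 2 + 1279249 * (k + 4) ^ 3 +
      631587 * (k + 4) ^ 4 + 193848 * (k + 4) ^ 5 + 36210 * (k + 4) ^ 6 + 3801 * (k + 4) ^ 7 +
      183 * (k + 4) ^ 8 + 2 * (k + 4) ^ 9) *
      ∫ w, wishartIntegrand k 0 w := by
  rw [integral_wishartIntegrand_zero, integral_wishartIntegrand k (j := 4) (by norm_num)
    (co := fun i =>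
      if i = 0 then 72576 + 39600 * (k + 2 : ℕ) + 8040 * (k + 2 : ℕ) ^ 2 + 720 * (k + 2 : ℕ) ^ 3
        + 24 * (k + 2 : ℕ) ^ 4
      else if i = 1 then -(580608 + 357120 * (k + 2 : ℕ) + 81840 * (k + 2 : ℕ) ^ 2
        + 8280 * (k + 2 : ℕ) ^ 3 + 312 * (k + 2 : ℕ) ^ 4)
      else if i = 2 then 1524096 + 1083600 * (k + 2 : ℕ) + 287160 * (k + 2 : ℕ) ^ 2
        + 33600 * (k + 2 : ℕ) ^ 3 + 1464 * (k + 2 : ℕ) ^ 4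
      else if i = 3 then -(1451520 + 1238400 * (k + 2 : ℕ) + 393600 * (k + 2 : ℕ) ^ 2
        + 55200 * (k + 2 : ℕ) ^ 3 + 2880 * (k + 2 : ℕ) ^ 4)
      else 362880 + 396000 * (k + 2 : ℕ) + 160800 * (k + 2 : ℕ) ^ 2 + 28800 * (k + 2 : ℕ) ^ 3
        + 1920 * (k + 2 : ℕ) ^ 4)
    (by intro a b; rw [blockPolySum_four]; simp [Finset.sum_range_succ]; ring)]
  simp [Finset.sum_range_succ, Nat.ascFactorial, Nat.factorial_succ]
  ring

/-! ### From the cone to the density matrices -/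

/-- The coordinates of a Hermitian `4 × 4` matrix. -/
def stateCoord (M : Matrix TwoQubit TwoQubit ℂ) : StateCoord :=
  ((((M (0, 0) (0, 0)).re, (M (0, 1) (0, 1)).re), M (0, 0) (0, 1)),
    ((((M (0, 0) (1, 0), M (0, 1) (1, 1)), M (0, 1) (1, 0)), M (0, 0) (1, 1)),
      (((M (1, 0) (1, 0)).re, (M (1, 1) (1, 1)).re), M (1, 0) (1, 1))))

theorem stateCoord_stateMatrix (w : StateCoord) : stateCoord (stateMatrix w) = w := by
  simp [stateCoord, stateMatrix, blockMatrix, twoQubitEquiv, hermMatrix, genMatrix]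

theorem stateMatrix_stateCoord {M : Matrix TwoQubit TwoQubit ℂ} (h : M.IsHermitian) :
    stateMatrix (stateCoord M) = M := by
  have hd : ∀ i, ((M i i).re : ℂ) = M i i := fun i => Complex.conj_eq_iff_re.mp (h.apply i i)
  have ho : ∀ i j, starRingEnd ℂ (M i j) = M j i := fun i j => h.apply j i
  ext ⟨i, i'⟩ ⟨j, j'⟩
  fin_cases i <;> fin_cases j <;> fin_cases i' <;> fin_cases j' <;>
    simp [stateCoord, stateMatrix, blockMatrix, twoQubitEquiv, hermMatrix, genMatrix, hd, ho]

/-- The matrix `t I / 4 + x`. -/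
noncomputable def coneMatrix (p : ℝ × TracelessHermitian) : Matrix TwoQubit TwoQubit ℂ :=
  ((p.1 / 4 : ℝ) : ℂ) • (1 : Matrix TwoQubit TwoQubit ℂ) + entryMatrix p.2

theorem isHermitian_coneMatrix (p : ℝ × TracelessHermitian) : (coneMatrix p).IsHermitian := by
  refine IsHermitian.add ?_ p.2.2.1
  ext i j
  by_cases h : i = j <;> simp [h, eq_comm]

theorem trace_coneMatrix (p : ℝ × TracelessHermitian) : (coneMatrix p).trace = p.1 := by
  rw [coneMatrix, trace_add, p.2.2.2, trace_smul, trace_one]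
  simp

theorem coneMatrix_one (x : TracelessHermitian) : coneMatrix (1, x) = stateOf x := by
  simp [coneMatrix, stateOf]

theorem coneMatrix_smul (t : ℝ) (x : TracelessHermitian) :
    coneMatrix (t, t • x) = (t : ℂ) • stateOf x := by
  ext i j
  simp [coneMatrix, stateOf, entryMatrix]
  ring

/-- The traceless part of a Hermitian matrix. -/
noncomputable def tracelessPart (w : StateCoord) : TracelessHermitian :=
  ⟨WithLp.toLp 2 fun q => (stateMatrix w - (((stateMatrix w).trace.re / 4 : ℝ) : ℂ) •
    (1 : Matrix TwoQubit TwoQubit ℂ)) q.1 q.2, by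
    have e : entryMatrix (WithLp.toLp 2 fun q => (stateMatrix w -
        (((stateMatrix w).trace.re / 4 : ℝ) : ℂ) • (1 : Matrix TwoQubit TwoQubit ℂ)) q.1 q.2) =
        stateMatrix w - (((stateMatrix w).trace.re / 4 : ℝ) : ℂ) •
          (1 : Matrix TwoQubit TwoQubit ℂ) := by
      ext i j; simp [entryMatrix]
    change (entryMatrix _).IsHermitian ∧ (entryMatrix _).trace = 0
    rw [e]
    refine ⟨(isHermitian_stateMatrix w).sub ?_, ?_⟩
    · ext i j
      by_cases h : i = j <;> simp [h, eq_comm]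
    · rw [trace_sub, trace_smul, trace_one, trace_stateMatrix]
      simp⟩

theorem coneMatrix_tracelessPart (w : StateCoord) :
    coneMatrix ((stateMatrix w).trace.re, tracelessPart w) = stateMatrix w := by
  ext i j; simp [coneMatrix, entryMatrix, tracelessPart]

/-- Every Hermitian matrix is uniquely `t I / 4 + x` with `x` traceless. -/
noncomputable def coneEquiv : (ℝ × TracelessHermitian) ≃ₗ[ℝ] StateCoord where
  toFun p := stateCoord (coneMatrix p)
  map_add' p q := by
    have h : coneMatrix (p + q) = coneMatrix p + coneMatrix q := by
      ext i j
      simp [coneMatrix, entryMatrix]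
      ring
    rw [h]
    simp [stateCoord]
  map_smul' r p := by
    have h : coneMatrix (r • p) = r • coneMatrix p := by
      ext i j
      simp [coneMatrix, entryMatrix]
      ring
    rw [h]
    simp [stateCoord]
  invFun w := ((stateMatrix w).trace.re, tracelessPart w)
  left_inv p := by
    refine Prod.ext ?_ (Subtype.ext ?_)
    · simp only [stateMatrix_stateCoord (isHermitian_coneMatrix p), trace_coneMatrix,
        Complex.ofReal_re]
    · ext q
      simp only [tracelessPart, stateMatrix_stateCoord (isHermitian_coneMatrix p),
        trace_coneMatrix, Complex.ofReal_re]
      simp [coneMatrix, entryMatrix]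
  right_inv w := by
    simp only [coneMatrix_tracelessPart, stateCoord_stateMatrix]

theorem stateMatrix_coneEquiv (p : ℝ × TracelessHermitian) :
    stateMatrix (coneEquiv p) = coneMatrix p := stateMatrix_stateCoord (isHermitian_coneMatrix p)

theorem finrank_tracelessHermitian : Module.finrank ℝ TracelessHermitian = 15 := by
  have h := coneEquiv.finrank_eq
  simp only [Module.finrank_prod, Module.finrank_self, Complex.finrank_real_complex] at h
  omega

/-- The Euclidean volume on traceless Hermitian matrices. -/
noncomputable def tracelessVolume : Measure TracelessHermitian :=
  (measureSpaceOfInnerProductSpace (E := TracelessHermitian)).volume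

instance : tracelessVolume.IsAddHaarMeasure := by
  unfold tracelessVolume; infer_instance

/-- Haar measure is unique up to scale. The Jacobian $c$ need not be known, as it cancels in moment
ratios. -/
theorem exists_integral_coneEquiv : ∃ c : ℝ, 0 < c ∧ ∀ f : StateCoord → ℝ,
    (Integrable f → Integrable (fun p => f (coneEquiv p))
      ((volume : Measure ℝ).prod tracelessVolume)) ∧
    ∫ p, f (coneEquiv p) ∂((volume : Measure ℝ).prod tracelessVolume) = c * ∫ w, f w := by
  set ν := (volume : Measure ℝ).prod tracelessVolume with hν
  set L := coneEquiv.toContinuousLinearEquiv with hL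
  have hH : (ν.map L).IsAddHaarMeasure := L.isAddHaarMeasure_map ν
  have hs := Measure.isAddLeftInvariant_eq_smul (ν.map L) (volume : Measure StateCoord)
  set c := Measure.addHaarScalarFactor (ν.map L) (volume : Measure StateCoord) with hc
  have hc0 : 0 < c := Measure.addHaarScalarFactor_pos_of_isAddHaarMeasure _ _
  have hemb : MeasurableEmbedding L := L.toHomeomorph.measurableEmbedding
  refine ⟨c, by exact_mod_cast hc0, fun f => ⟨fun hf => ?_, ?_⟩⟩
  · have h1 : Integrable f (ν.map L) := by
      rw [hs]; exact hf.smul_measure_nnreal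
    exact (hemb.integrable_map_iff).mp h1
  · have h2 := hemb.integral_map (μ := ν) f
    rw [hs, integral_smul_nnreal_measure] at h2
    exact h2.symm

/-- The set of two-qubit density matrices. -/
def densitySet : Set TracelessHermitian := {x | IsDensityMatrix (stateOf x)}

theorem mem_densitySet_iff (x : TracelessHermitian) :
    x ∈ densitySet ↔ (stateOf x).PosSemidef := by
  refine ⟨fun h => h.1, fun h => ⟨h, ?_⟩⟩
  rw [← coneMatrix_one, trace_coneMatrix]; simp

theorem continuous_stateOf : Continuous stateOf := by
  refine continuous_pi fun i => continuous_pi fun j => ?_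
  simp only [stateOf, entryMatrix, Matrix.add_apply, Matrix.smul_apply, of_apply]
  fun_prop

theorem continuous_det_stateOf : Continuous fun x => (stateOf x).det.re :=
  Complex.continuous_re.comp continuous_stateOf.matrix_det

theorem continuous_det_partialTranspose_stateOf :
    Continuous fun x => (partialTranspose (stateOf x)).det.re :=
  Complex.continuous_re.comp (continuous_partialTranspose.comp continuous_stateOf).matrix_det

theorem continuous_detProduct (k n : ℕ) : Continuous (detProduct k n) :=
  (continuous_det_stateOf.pow k).mul (continuous_det_partialTranspose_stateOf.pow n)

/-- The set is closed, and unit trace bounds every coordinate of a positive matrix by 1. -/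
theorem isCompact_densitySet : IsCompact densitySet := by
  have hcl : IsClosed densitySet := by
    have : densitySet = stateOf ⁻¹' {M | M.PosSemidef} := by
      ext x; exact mem_densitySet_iff x
    rw [this]
    exact isClosed_setOf_posSemidef.preimage continuous_stateOf
  have hcont : Continuous (fun w => (coneEquiv.symm w).2) :=
    continuous_snd.comp (LinearMap.continuous_of_finiteDimensional
      (coneEquiv.symm : StateCoord →ₗ[ℝ] ℝ × TracelessHermitian))
  refine ((isCompact_closedBall (0 : StateCoord) 1).image hcont).of_isClosed_subset hcl
    fun x hx => ?_
  have hpsd : (stateMatrix (coneEquiv (1, x))).PosSemidef := by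
    rw [stateMatrix_coneEquiv, coneMatrix_one]; exact (mem_densitySet_iff x).mp hx
  have hnorm : ‖coneEquiv (1, x)‖ ≤ 1 := by
    have := norm_le_trace_of_posSemidef hpsd
    rwa [stateMatrix_coneEquiv, trace_coneMatrix, Complex.ofReal_re] at this
  exact ⟨coneEquiv (1, x), mem_closedBall_zero_iff.mpr hnorm,
    congrArg Prod.snd (coneEquiv.symm_apply_apply (1, x))⟩

theorem measurableSet_densitySet : MeasurableSet densitySet :=
  isCompact_densitySet.isClosed.measurableSet

open scoped Nat in
/-- Integration over the rays of the cone of positive semidefinite matrices. -/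
theorem integral_wishartIntegrand_coneEquiv (k j : ℕ) :
    ∫ p, wishartIntegrand k j (coneEquiv p) ∂((volume : Measure ℝ).prod tracelessVolume) =
      (15 + 4 * (k + j))! * ∫ x in densitySet, (stateOf x).det.re ^ k *
        ((partialTranspose (stateOf x)).det.re - (stateOf x).det.re) ^ j ∂tracelessVolume := by
  obtain ⟨c, -, hc⟩ := exists_integral_coneEquiv
  rw [integral_prod _ ((hc _).1 (integrable_wishartIntegrand k j)),
    ← integral_indicator measurableSet_densitySet]
  set H : TracelessHermitian → ℝ := densitySet.indicator fun x => (stateOf x).det.re ^ k *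
        ((partialTranspose (stateOf x)).det.re - (stateOf x).det.re) ^ j with hH
  have key : ∀ t : ℝ, t ≠ 0 → ∫ x, wishartIntegrand k j (coneEquiv (t, x)) ∂tracelessVolume =
      gammaWeight (15 + 4 * (k + j)) t * ∫ x, H x ∂tracelessVolume := by
    intro t ht
    rcases lt_or_gt_of_ne ht with h | h
    · have h0 : ∀ x, wishartIntegrand k j (coneEquiv (t, x)) = 0 := by
        intro x
        rw [wishartIntegrand, if_neg]
        intro hpsd
        have := (norm_nonneg _).trans (norm_le_trace_of_posSemidef hpsd)
        rw [stateMatrix_coneEquiv, trace_coneMatrix, Complex.ofReal_re] at this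
        exact absurd this (not_le.mpr h)
      simp [h0, gammaWeight, not_le.mpr h]
    -- Rescaling the 15-dimensional slice gives $t^{15}$ and homogeneity of the determinants gives
    -- $t^{4(k+j)}$, which together make the Gamma weight.
    · have h1 := Measure.integral_comp_smul tracelessVolume
        (fun x => wishartIntegrand k j (coneEquiv (t, x))) t
      have h2 : ∀ x, wishartIntegrand k j (coneEquiv (t, t • x)) =
          t ^ (4 * (k + j)) * Real.exp (-t) * H x := by
        intro x
        have hM : stateMatrix (coneEquiv (t, t • x)) = (t : ℂ) • stateOf x := by
          rw [stateMatrix_coneEquiv, coneMatrix_smul]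
        have hPT : partialTranspose ((t : ℂ) • stateOf x) =
            (t : ℂ) • partialTranspose (stateOf x) := by
          ext i j; simp [partialTranspose]
        have hc : Fintype.card TwoQubit = 4 := rfl
        have hdet : ∀ M : Matrix TwoQubit TwoQubit ℂ, ((t : ℂ) • M).det.re = t ^ 4 * M.det.re := by
          intro M
          rw [det_smul, hc, ← Complex.ofReal_pow, Complex.re_ofReal_mul]
        have hpsd : ((t : ℂ) • stateOf x).PosSemidef ↔ x ∈ densitySet := by
          rw [mem_densitySet_iff]
          have ht' : (t : ℂ) ≠ 0 := by exact_mod_cast h.ne'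
          refine ⟨fun hp => ?_, fun hp => hp.smul (Complex.zero_le_real.mpr h.le)⟩
          have := hp.smul (Complex.zero_le_real.mpr (inv_nonneg.mpr h.le))
          rwa [smul_smul, ← Complex.ofReal_mul, inv_mul_cancel₀ h.ne', Complex.ofReal_one,
            one_smul] at this
        have htr : ((t : ℂ) • stateOf x).trace.re = t := by
          rw [← coneMatrix_smul, trace_coneMatrix, Complex.ofReal_re]
        by_cases hx : x ∈ densitySet
        · rw [wishartIntegrand, hM, if_pos (hpsd.mpr hx), hH, Set.indicator_of_mem hx, hPT, hdet,
            hdet, htr, ← mul_sub, mul_pow, mul_pow, mul_add, pow_add, pow_mul, pow_mul]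
          ring
        · rw [wishartIntegrand, hM, if_neg (mt hpsd.mp hx), hH, Set.indicator_of_notMem hx,
            mul_zero]
      simp only [h2, finrank_tracelessHermitian] at h1
      rw [integral_const_mul, abs_of_pos (by positivity), smul_eq_mul] at h1
      rw [gammaWeight, if_pos h.le, pow_add]
      field_simp at h1
      linear_combination -h1
  rw [integral_congr_ae (g := fun t => gammaWeight (15 + 4 * (k + j)) t *
      ∫ x, H x ∂tracelessVolume),
    integral_mul_const, integral_gammaWeight]
  have : ∀ᵐ t : ℝ, t ≠ 0 := by simp [ae_iff]
  filter_upwards [this] with t ht using key t ht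

theorem integrable_detProduct (k n : ℕ) : Integrable (detProduct k n) hsMeasure := by
  have h : IntegrableOn (detProduct k n) densitySet tracelessVolume :=
    (continuous_detProduct k n).continuousOn.integrableOn_compact isCompact_densitySet
  -- For a null set the conditional measure would be zero, so positivity of the volume is not needed
  -- yet.
  by_cases h0 : tracelessVolume densitySet = 0
  · have : hsMeasure = 0 := ProbabilityTheory.cond_eq_zero_of_meas_eq_zero h0
    rw [this]; exact integrable_zero_measure
  · exact Integrable.smul_measure h (ENNReal.inv_ne_top.mpr h0)

/-! ### Hilbert–Schmidt moments and their ratios -/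

open scoped Nat in
/-- The Hilbert-Schmidt moments in terms of integrals over the cone. -/
theorem exists_hsMoment_eq : ∃ κ : ℝ, 0 < κ ∧ ∀ k n : ℕ,
    hsMoment k n * (15 + 4 * (k + n))! = κ * ∑ j ∈ Finset.range (n + 1),
      (n.choose j : ℝ) * ∫ w, wishartIntegrand (k + (n - j)) j w := by
  obtain ⟨c, hc0, hc⟩ := exists_integral_coneEquiv
  have hcone : ∀ k j : ℕ, c * ∫ w, wishartIntegrand k j w = (15 + 4 * (k + j))! *
      ∫ x in densitySet, (stateOf x).det.re ^ k *
        ((partialTranspose (stateOf x)).det.re - (stateOf x).det.re) ^ j ∂tracelessVolume :=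
    fun k j => by rw [← (hc _).2, integral_wishartIntegrand_coneEquiv]
  -- The cone identity at $k=j=0$ equates a positive Wishart integral with $15!$ times this volume.
  have hvol : 0 < (tracelessVolume densitySet).toReal := by
    have h1 := hcone 0 0
    have h2 : 0 < ∫ w, wishartIntegrand 0 0 w := by
      rw [integral_wishartIntegrand_zero]; positivity
    simp only [pow_zero, mul_one, setIntegral_const, smul_eq_mul] at h1
    have h3 := mul_pos hc0 h2
    rw [h1] at h3
    exact pos_of_mul_pos_right h3 (by positivity)
  refine ⟨(tracelessVolume densitySet)⁻¹.toReal * c, ?_, fun k n => ?_⟩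
  · rw [ENNReal.toReal_inv]; positivity
  · have h1 : hsMoment k n = (tracelessVolume densitySet)⁻¹.toReal *
        ∫ x in densitySet, detProduct k n x ∂tracelessVolume := by
      rw [hsMoment, hsMeasure, ProbabilityTheory.cond, integral_smul_measure]; rfl
    have h2 : ∀ x, detProduct k n x = ∑ j ∈ Finset.range (n + 1), (n.choose j : ℝ) *
        ((stateOf x).det.re ^ (k + (n - j)) *
          ((partialTranspose (stateOf x)).det.re - (stateOf x).det.re) ^ j) := by
      intro x
      have e : (partialTranspose (stateOf x)).det.re =
        ((partialTranspose (stateOf x)).det.re - (stateOf x).det.re) + (stateOf x).det.re := by ring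
      rw [detProduct]
      conv_lhs => rw [e, add_pow, Finset.mul_sum]
      refine Finset.sum_congr rfl fun j _ => ?_
      rw [pow_add]; ring
    have hI : ∀ k j : ℕ, IntegrableOn (fun x => (stateOf x).det.re ^ k *
        ((partialTranspose (stateOf x)).det.re - (stateOf x).det.re) ^ j) densitySet
        tracelessVolume := fun k j =>
      ((continuous_det_stateOf.pow k).mul ((continuous_det_partialTranspose_stateOf.sub
        continuous_det_stateOf).pow j)).continuousOn.integrableOn_compact isCompact_densitySet
    have h3 : ∫ x in densitySet, detProduct k n x ∂tracelessVolume =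
        ∑ j ∈ Finset.range (n + 1), (n.choose j : ℝ) * ∫ x in densitySet,
          (stateOf x).det.re ^ (k + (n - j)) *
          ((partialTranspose (stateOf x)).det.re - (stateOf x).det.re) ^ j ∂tracelessVolume := by
      simp only [h2]
      rw [integral_finsetSum _ fun j _ => (hI _ _).const_mul _]
      simp only [integral_const_mul]
    rw [h1, h3, mul_assoc, mul_assoc, Finset.sum_mul, Finset.mul_sum _ _ c]
    congr 1
    refine Finset.sum_congr rfl fun j hj => ?_
    rw [Finset.mem_range] at hj
    have h4 := hcone (k + (n - j)) j
    rw [show k + (n - j) + j = k + n by omega] at h4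
    linear_combination -(n.choose j : ℝ) * h4

theorem qubitDenominator_zero (k : ℕ) : qubitDenominator 0 k = 1 := by
  simp [qubitDenominator]

theorem qubitDenominator_succ (n k : ℕ) : qubitDenominator (n + 1) k =
    qubitDenominator n k * (8 * (2 * k + 2 * n + 9) * (4 * k + 4 * n + 17) *
      (4 * k + 4 * n + 19)) := by
  simp only [qubitDenominator, show 2 * (n + 1) = 2 * n + 1 + 1 by ring,
    show 6 * (n + 1) = 6 * n + 6 by ring, ascPochhammer_succ_eval, pow_add]
  push_cast
  ring

theorem qubitDenominator_pos (n k : ℕ) : 0 < qubitDenominator n k := by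
  induction n with
  | zero => simp [qubitDenominator_zero]
  | succ n ih => rw [qubitDenominator_succ]; positivity

open scoped Nat in
-- With $m=k+n$, the step from $n$ to $n+1$ adds the factors $4m+16,\dots,4m+19$: the first is
-- $4(m+4)$, the third $2(2m+9)$, and apart from $m+4$ they form the new factor of the denominator.
theorem factorial_eq_mul_qubitDenominator (n k : ℕ) : ((15 + 4 * (k + n))! : ℝ) =
    (15 + 4 * k)! * ((ascPochhammer ℝ n).eval ((k : ℝ) + 4) * qubitDenominator n k) := by
  induction n with
  | zero => simp [qubitDenominator_zero]
  | succ n ih =>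
    rw [show 15 + 4 * (k + (n + 1)) = 15 + 4 * (k + n) + 1 + 1 + 1 + 1 by ring]
    simp only [Nat.factorial_succ]
    push_cast
    rw [ih, ascPochhammer_succ_eval, qubitDenominator_succ]
    ring

open scoped Nat in
theorem hsMoment_zero_pos (k : ℕ) : 0 < hsMoment k 0 := by
  obtain ⟨κ, hκ, h⟩ := exists_hsMoment_eq
  have h0 := h k 0
  rw [Finset.sum_range_one, integral_wishartIntegrand_zero] at h0
  refine pos_of_mul_pos_left (b := ((15 + 4 * (k + 0))! : ℝ)) ?_ (by positivity)
  rw [h0, Nat.choose_self, Nat.cast_one, one_mul]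
  positivity

/-- The moment ratio, from an identity between integrals over the cone. -/
theorem hsMoment_mul_qubitDenominator {n k : ℕ} {p : ℝ}
    (h : ∑ j ∈ Finset.range (n + 1),
        (n.choose j : ℝ) * ∫ w, wishartIntegrand (k + (n - j)) j w =
      (ascPochhammer ℝ n).eval ((k : ℝ) + 4) * p * ∫ w, wishartIntegrand k 0 w) :
    hsMoment k n * qubitDenominator n k = p * hsMoment k 0 := by
  obtain ⟨κ, hκ, hm⟩ := exists_hsMoment_eq
  have h1 := hm k n
  have h0 := hm k 0
  rw [h, factorial_eq_mul_qubitDenominator] at h1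
  simp only [Finset.sum_range_one, zero_add, Nat.choose_self, Nat.cast_one, one_mul, add_zero,
    Nat.sub_self] at h0
  have ha : 0 < (ascPochhammer ℝ n).eval ((k : ℝ) + 4) := ascPochhammer_pos _ _ (by positivity)
  have hf : (0 : ℝ) < (15 + 4 * k).factorial := by positivity
  -- The scale $\kappa$ drops out by comparison with the case $n=0$; the common factors are
  -- $(15+4k)!$ and $(k+4)_n$.
  refine mul_left_cancel₀ (mul_pos hf ha).ne' ?_
  linear_combination h1 - (ascPochhammer ℝ n).eval ((k : ℝ) + 4) * p * h0

theorem hsMoment_one_mul (k : ℕ) :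
    hsMoment k 1 * qubitDenominator 1 k = (qubitNumerator 1).eval (k : ℝ) * hsMoment k 0 := by
  apply hsMoment_mul_qubitDenominator
  simp only [Finset.sum_range_succ, Finset.sum_range_zero, Nat.sub_zero, Nat.sub_self, add_zero,
    integral_wishartIntegrand_succ_zero, integral_wishartIntegrand_one, Nat.choose,
    ascPochhammer_succ_eval, ascPochhammer_zero, eval_one, qubitNumerator, eval_add, eval_sub,
    eval_mul, eval_pow, eval_X, eval_ofNat]
  push_cast
  ring

/-- Writing shifts of $k$ as iterated successors lets `integral_wishartIntegrand_succ_zero` reduce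
every term to a polynomial multiple of the integral at $(k,0)$; a polynomial identity in $k$
remains. -/
theorem hsMoment_two_mul (k : ℕ) :
    hsMoment k 2 * qubitDenominator 2 k = (qubitNumerator 2).eval (k : ℝ) * hsMoment k 0 := by
  apply hsMoment_mul_qubitDenominator
  simp only [Finset.sum_range_succ, Finset.sum_range_zero, Nat.sub_zero, Nat.sub_self, add_zero,
    Nat.reduceSub, show k + 2 = k + 1 + 1 by ring,
    integral_wishartIntegrand_succ_zero, integral_wishartIntegrand_one,
    integral_wishartIntegrand_two, Nat.choose,
    ascPochhammer_succ_eval, ascPochhammer_zero, eval_one, qubitNumerator, eval_add,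
    eval_mul, eval_pow, eval_X, eval_ofNat]
  push_cast
  ring

theorem hsMoment_three_mul (k : ℕ) :
    hsMoment k 3 * qubitDenominator 3 k = (qubitNumerator 3).eval (k : ℝ) * hsMoment k 0 := by
  apply hsMoment_mul_qubitDenominator
  simp only [Finset.sum_range_succ, Finset.sum_range_zero, Nat.sub_zero, Nat.sub_self, add_zero,
    Nat.reduceSub, show k + 2 = k + 1 + 1 by ring, show k + 3 = k + 1 + 1 + 1 by ring,
    integral_wishartIntegrand_succ_zero, integral_wishartIntegrand_one,
    integral_wishartIntegrand_two, integral_wishartIntegrand_three, Nat.choose,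
    ascPochhammer_succ_eval, ascPochhammer_zero, eval_one, qubitNumerator, eval_add, eval_sub,
    eval_mul, eval_pow, eval_X, eval_ofNat]
  push_cast
  ring

theorem hsMoment_four_mul (k : ℕ) :
    hsMoment k 4 * qubitDenominator 4 k = (qubitNumerator 4).eval (k : ℝ) * hsMoment k 0 := by
  apply hsMoment_mul_qubitDenominator
  simp only [Finset.sum_range_succ, Finset.sum_range_zero, Nat.sub_zero, Nat.sub_self, add_zero,
    Nat.reduceSub, show k + 2 = k + 1 + 1 by ring, show k + 3 = k + 1 + 1 + 1 by ring,
    show k + 4 = k + 1 + 1 + 1 + 1 by ring,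
    integral_wishartIntegrand_succ_zero, integral_wishartIntegrand_one,
    integral_wishartIntegrand_two, integral_wishartIntegrand_three,
    integral_wishartIntegrand_four, Nat.choose,
    ascPochhammer_succ_eval, ascPochhammer_zero, eval_one, qubitNumerator, eval_add, eval_sub,
    eval_mul, eval_pow, eval_X, eval_ofNat]
  push_cast
  ring

theorem hsMoment_mul {n : ℕ} (h1 : 1 ≤ n) (h4 : n ≤ 4) (k : ℕ) :
    hsMoment k n * qubitDenominator n k = (qubitNumerator n).eval (k : ℝ) * hsMoment k 0 := by
  interval_cases n
  · exact hsMoment_one_mul k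
  · exact hsMoment_two_mul k
  · exact hsMoment_three_mul k
  · exact hsMoment_four_mul k

theorem monic_qubitNumerator_and_natDegree {n : ℕ} (h1 : 1 ≤ n) (h4 : n ≤ 4) :
    (qubitNumerator n).Monic ∧ (qubitNumerator n).natDegree = 3 * n := by
  have hdeg : (qubitNumerator n).natDegree = 3 * n := by
    interval_cases n <;> simp only [qubitNumerator, Nat.reduceMul] <;> compute_degree!
  refine ⟨?_, hdeg⟩
  rw [Monic, leadingCoeff, hdeg]
  interval_cases n <;> simp [qubitNumerator, coeff_X, coeff_X_pow, coeff_ofNat_mul]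

theorem mainTheorem2 :
    (∀ k n : ℕ, Integrable (detProduct k n) hsMeasure) ∧
    (∀ k : ℕ, 0 < hsMoment k 0) ∧
    (∀ n : ℕ, 1 ≤ n → n ≤ 4 →
      (qubitNumerator n).Monic ∧ (qubitNumerator n).natDegree = 3 * n ∧
      ∀ k : ℕ, hsMoment k n / hsMoment k 0 =
        (qubitNumerator n).eval (k : ℝ) / qubitDenominator n k) ∧
    (∀ k : ℕ, hsMoment k 1 =
      ((k : ℝ) * (k * (k + 6) - 1) - 42) / (8 * (2 * k + 9) * (4 * k + 17) * (4 * k + 19))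
        * hsMoment k 0) ∧
    (∀ k : ℕ, hsMoment k 2 =
      ((k : ℝ) * (k * (k * (k * (k * (k + 15) + 67) + 45) + 220) + 4260) + 10944)
        / (64 * (2 * k + 9) * (2 * k + 11) * (4 * k + 17) * (4 * k + 19) * (4 * k + 21)
            * (4 * k + 23))
        * hsMoment k 0) := by
  refine ⟨integrable_detProduct, hsMoment_zero_pos, fun n h1 h4 =>
    ⟨(monic_qubitNumerator_and_natDegree h1 h4).1,
      (monic_qubitNumerator_and_natDegree h1 h4).2, fun k => ?_⟩, fun k => ?_, fun k => ?_⟩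
  · rw [div_eq_div_iff (hsMoment_zero_pos k).ne' (qubitDenominator_pos n k).ne',
      hsMoment_mul h1 h4]
  · rw [div_mul_eq_mul_div, eq_div_iff (by positivity)]
    convert hsMoment_mul (n := 1) le_rfl (by norm_num) k using 2
    · rw [qubitDenominator_succ, qubitDenominator_zero]
      push_cast
      ring
    · simp only [qubitNumerator, eval_add, eval_sub, eval_mul, eval_pow, eval_X, eval_ofNat]
      ring
  · rw [div_mul_eq_mul_div, eq_div_iff (by positivity)]
    convert hsMoment_mul (n := 2) (by norm_num) (by norm_num) k using 2
    · rw [qubitDenominator_succ, qubitDenominator_succ, qubitDenominator_zero]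
      push_cast
      ring
    · simp only [qubitNumerator, eval_add, eval_mul, eval_pow, eval_X, eval_ofNat]
      ring
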